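/- **Setting.** For a finite set $\Lambda\subset\mathbb Z^2$ let $\mathcal A_\Lambda$ be the algebra of linear operators on $\mathcal H_\Lambda=\bigotimes_{x\in\Lambda}\mathbb C^2$, with the operator norm; for $X\subset\Lambda$, $\mathcal A_X$ is identified with a subalgebra of $\mathcal A_\Lambda$ through $A\mapsto A\otimes\mathbb 1$. An interaction $\Phi$ assigns to every finite $X\subset\mathbb Z^2$ an operator $\Phi(X)=\Phi(X)^*\in\mathcal A_X$, and $H_\Lambda=\sum_{X\subset\Lambda}\Phi(X)$. Let $$\alpha_1=\sigma_3=\begin{pmatrix}1&0\\0&-1\end{pmatrix},\qquad \alpha_2=\sigma_1=\begin{pmatrix}0&1\\1&0\end{pmatrix},$$ and let $\Phi$ be the interaction with $\Phi(\{x,y\})=H_{x,y}=\alpha_1\otimes\alpha_2$ ($\alpha_1$ acting at $x$, $\alpha_2$ at $y$) whenever $y=x+(1,0)$ or $y=x-(0,1)$, and $\Phi(X)=0$ for every other $X$. **Trees.** Put $E_0=400$, $E_1=4^{20}$ and $E_k=4^{\sqrt{E_{k-1}}}$ for $k\ge2$ (all integers). The unfolded tree $\tilde T_j\subset\mathbb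 Z^2$ ($j\ge1$) is rooted at the origin and consists of straight lattice segments of levels $j+1,j,\dots,1$, each going right, in direction $(1,0)$, or down, in direction $(0,-1)$. There is one segment of level $j+1$; it starts at the origin and goes right. A segment of level $1$ has $E_1$ edges and no branches. A segment of level $i\ge2$ has $4E_iE_{i-2}/E_{i-1}$ edges, and at the distances $4E_{i-2},\,2\cdot4E_{i-2},\,3\cdot 4E_{i-2},\dots$ from its starting point, up to and including its end point, a segment of level $i-1$ going in the other of the two directions starts from it ($E_i/E_{i-1}$ segments in all). **Theorem.** The interaction $\Phi$ is self-adjoint, nearest-neighbour and translation invariant, and $\|H_{x,y}\|=1$ for all nearest neighbours $x,y$. Let $\Lambda_0\subset\Lambda_1\subset\Lambda_2\subset\cdots$ be square boxes in $\mathbb Z^2$ (sets of the form $\{a,\dots,a+L\}\times\{b,\dots,b+L\}$) such that $\Lambda_j$ contains the vertices of $\tilde T_j$ for every $j\ge1$, and let $A=\alpha_2$ at the origin. Then $$\lim_{j\to\infty}\bigl\|e^{izH_{\Lambda_j}}\,A\,e^{-izH_{\Lambda_j}}\bigr\|=\infty$$ for every purely imaginary $z$ with $|z|>4^{21}$. 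-/

import Mathlib

open Filter
open scoped Matrix.Norms.L2Operator

noncomputable section

namespace SpinLattice

/-! ### Quantum spin systems on the square lattice, with local Hilbert space `ℂ²` -/

/-- Sites of the square lattice. -/
abbrev Site : Type := ℤ × ℤ

/-- The algebra of observables of a finite region `X`: operators on `⨂_{x ∈ X} ℂ²`, written as
matrices in the product basis, which is indexed by the configurations `X → Fin 2`.
The norm `‖·‖` on it is the operator norm for the Hilbert space norm
(scope `Matrix.Norms.L2Operator`). -/
abbrev Obs (X : Finset Site) : Type :=
  Matrix ({x // x ∈ X} → Fin 2) ({x // x ∈ X} → Fin 2) ℂ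

/-- The identification of `A ∈ 𝒜_X` with `A ⊗ 𝟙 ∈ 𝒜_Λ` for `X ⊆ Λ`
(the value is `0` if `X` is not contained in `Λ`). -/
def embed (X Λ : Finset Site) (A : Obs X) : Obs Λ :=
  if h : X ⊆ Λ then
    Matrix.of fun σ τ =>
      if ∀ x : {x // x ∈ Λ}, x.1 ∉ X → σ x = τ x then
        A (fun x => σ ⟨x.1, h x.2⟩) (fun x => τ ⟨x.1, h x.2⟩)
      else 0
  else 0

/-- An interaction assigns an observable of `X` to every finite region `X`. (Self-adjointness is
the separate predicate `IsSelfAdjointInteraction`.) -/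
abbrev Interaction : Type := ∀ X : Finset Site, Obs X

/-- `Φ(X)* = Φ(X)` for all finite `X`. -/
def IsSelfAdjointInteraction (Φ : Interaction) : Prop :=
  ∀ X, (Φ X).IsHermitian

/-- Two sites at distance one. -/
def NearestNeighbor (x y : Site) : Prop :=
  |x.1 - y.1| + |x.2 - y.2| = 1

/-- `Φ(X) = 0` unless `X` is a pair of nearest neighbours. -/
def IsNearestNeighborInteraction (Φ : Interaction) : Prop :=
  ∀ X : Finset Site, (¬ ∃ x y : Site, NearestNeighbor x y ∧ X = {x, y}) → Φ X = 0

/-- The translate `X + a` of a finite region. -/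
def translate (a : Site) (X : Finset Site) : Finset Site :=
  X.map (addRightEmbedding a)

theorem add_mem_translate (a : Site) (X : Finset Site) (x : {x // x ∈ X}) :
    x.1 + a ∈ translate a X :=
  Finset.mem_map_of_mem (addRightEmbedding a) x.2

/-- `Φ(X + a)` is the translate of `Φ(X)` by `a`. -/
def IsTranslationInvariant (Φ : Interaction) : Prop :=
  ∀ (a : Site) (X : Finset Site) (σ τ : {x // x ∈ translate a X} → Fin 2),
    Φ (translate a X) σ τ =
      Φ X (fun x => σ ⟨x.1 + a, add_mem_translate a X x⟩)
        (fun x => τ ⟨x.1 + a, add_mem_translate a X x⟩)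

/-- The local Hamiltonian `H_Λ = ∑_{X ⊆ Λ} Φ(X)`. -/
def hamiltonian (Φ : Interaction) (Λ : Finset Site) : Obs Λ :=
  ∑ X ∈ Λ.powerset, embed X Λ (Φ X)

/-- The complex-time evolution `e^{izH_Λ} A e^{-izH_Λ}`. -/
def evolution (Φ : Interaction) (Λ : Finset Site) (z : ℂ) (A : Obs Λ) : Obs Λ :=
  NormedSpace.exp ((Complex.I * z) • hamiltonian Φ Λ) * A *
    NormedSpace.exp (-((Complex.I * z) • hamiltonian Φ Λ))

/-! ### The particular interaction and observable -/

/-- `α₁ = σ₃`. -/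
def alpha1 : Matrix (Fin 2) (Fin 2) ℂ := !![1, 0; 0, -1]

/-- `α₂ = σ₁`. -/
def alpha2 : Matrix (Fin 2) (Fin 2) ℂ := !![0, 1; 1, 0]

/-- The interaction with `Φ({x, y}) = α₁ ⊗ α₂` (`α₁` acting at `x`, `α₂` at `y`) whenever
`y = x + (1, 0)` or `y = x - (0, 1)`, and `Φ(X) = 0` for all other `X`. For every `X` at most one
ordered pair `(x, y)` contributes to the sum. -/
def crossInteraction : Interaction := fun X =>
  Matrix.of fun σ τ =>
    ∑ x : {x // x ∈ X}, ∑ y : {x // x ∈ X},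
      if X = {x.1, y.1} ∧ (y.1 = x.1 + (1, 0) ∨ y.1 = x.1 - (0, 1)) then
        alpha1 (σ x) (τ x) * alpha2 (σ y) (τ y)
      else 0

/-- `α₂` at the origin. -/
def originObs : Obs {(0 : Site)} :=
  Matrix.of fun σ τ => alpha2 (σ ⟨0, Finset.mem_singleton_self 0⟩)
    (τ ⟨0, Finset.mem_singleton_self 0⟩)

/-! ### Square boxes and the unfolded trees -/

/-- `Λ` is a square block of lattice sites. -/
def IsSquareBox (Λ : Finset Site) : Prop :=
  ∃ (a b : ℤ) (L : ℕ), Λ = Finset.Icc a (a + L) ×ˢ Finset.Icc b (b + L)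

/-- `E₀ = 400`, `E₁ = 4²⁰`, `E_k = 4 ^ √E_{k-1}` for `k ≥ 2`. For `k ≥ 1` the number `E_k` is a
power of `4`, so that the integer square root is the true square root. -/
def E : ℕ → ℕ
  | 0 => 400
  | 1 => 4 ^ 20
  | k + 2 => 4 ^ Nat.sqrt (E (k + 1))

/-- The vertices on the lattice segment of `l` edges that leaves `p` in the direction `u`. -/
def segment (u p : Site) (l : ℕ) : Set Site :=
  {q | ∃ t : ℕ, t ≤ l ∧ q = p + t • u}

/-- The vertices of the cluster of level `n` (a segment of level `n + 1` with all its descendants)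
based at `p`, with main segment in direction `u`; the directions alternate between `u` and `v`.
A segment of level `1` has `E₁` edges and no branches. A segment of level `j ≥ 2` has
`4 E_j E_{j-2} / E_{j-1}` edges; a cluster of level `j - 2` branches off after every `4 E_{j-2}`
edges, hence `E_j / E_{j-1}` times, the last time at the tip. Both quotients are exact. -/
def cluster : ℕ → Site → Site → Site → Set Site
  | 0, u, _, p => segment u p (E 1)
  | n + 1, u, v, p =>
      segment u p (4 * E (n + 2) * E n / E (n + 1)) ∪
        ⋃ i ∈ Set.Icc 1 (E (n + 2) / E (n + 1)), cluster n v u (p + (i * (4 * E n)) • u)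

/-- The vertex set of the unfolded tree `T̃_j`: its root is the origin, its longest segment (of
level `j + 1`) goes to the right, and along it one only ever moves right or down. -/
def unfoldedTree (j : ℕ) : Set Site :=
  cluster j (1, 0) (0, -1) 0

end SpinLattice

end

open SpinLattice

/-! Three ingredients give a lower bound that is exponential in the number of sites of a dyadic
square, with a base that beats the losses once `|z|` exceeds `4^21`.

Spectral: at imaginary time the evolution is `e^{tH} A e^{-tH}` with `t` real. In an eigenbasis of
`H` it multiplies the entry `(i, j)` of `A` by `e^{t(l_i - l_j)}`. Since `A` is Hermitian, the
squared Hilbert-Schmidt norm is a sum of hyperbolic cosines. All terms of their power series are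
nonnegative, so every single iterated commutator bounds the evolution from below
(`hsSq_comm_le_evolution`), without cancellation between orders.

Combinatorial: `H` is a sum of Pauli operators, one per directed edge. In the commutator of order
`n`, consider the coefficient of the Pauli string of a tree with `n` edges rooted at the origin. The
string determines the edge set (`eqOn_of_tails_eq`), so only orderings of these edges contribute; an
ordering survives only if each edge is attached after its parent, and then every step contributes a
factor `2`. The coefficient thus counts linear extensions of the tree order, and there are at least
`n!` divided by the product of the hook lengths (`card_mul_hookWeight_le`). The factor `n!`
compensates the `(2n)!` of the cosh series (`pow_mul_hookWeight_le`).

Geometric: a hierarchical spanning tree of the square of side `2^m` has hook product at most `4^(5 *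
4^m)` (`le_hookWeight_treeVertices`), because most sites have few descendants. The unfolded trees
serve only to force the boxes to contain these squares (`dyadicBox_subset`). -/

noncomputable section

namespace SpinLattice

/-! ### Hook length lower bound for linear extensions of a finite poset -/

open Classical in
/-- The number of elements of `S` strictly above `e`. -/
def above {α : Type*} (r : α → α → Prop) (S : Finset α) (e : α) : ℕ :=
  (S.filter fun z => r e z).card

open Classical in
/-- The reciprocal of the product of the hook lengths of a finite poset. -/
def hookWeight {α : Type*} (r : α → α → Prop) (S : Finset α) : ℝ :=
  ∏ e ∈ S, ((above r S e : ℝ) + 1)⁻¹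

open Classical in
/-- The ratio between the hook weights of `S` with and without its maximal element `l`. -/
def hookRatio {α : Type*} (r : α → α → Prop) (S : Finset α) (l : α) : ℝ :=
  ∏ e ∈ S, if r e l then ((above r S e : ℝ) + 1) / above r S e else 1

theorem above_pos {α : Type*} {r : α → α → Prop} {S : Finset α} {e l : α} (hl : l ∈ S)
    (h : r e l) : 0 < above r S e := by
  classical
  exact Finset.card_pos.2 ⟨l, by simp [hl, h]⟩

theorem one_le_hookFactor {α : Type*} {r : α → α → Prop} {S : Finset α} {e l : α} (hl : l ∈ S)
    (h : r e l) : 1 ≤ ((above r S e : ℝ) + 1) / above r S e := by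
  have : (0 : ℝ) < above r S e := by exact_mod_cast above_pos hl h
  rw [le_div_iff₀ this]
  linarith

-- This is the hook length inequality in the form in which it passes through an induction: removing
-- a maximal `l` lowers by one the hook length of each element below `l`, which changes the hook
-- weight by exactly `hookRatio`. The induction deletes a minimal element `a` and shows that the
-- right side drops by at least one, using the hypothesis for the rest and also for the set `U`
-- above `a`.
open Classical in
theorem card_le_sum_hookRatio {α : Type*} (r : α → α → Prop) [IsStrictOrder α r] (S : Finset α) :
    (S.card : ℝ) ≤ ∑ l ∈ S with ∀ z ∈ S, ¬ r l z, hookRatio r S l := by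
  induction S using Finset.strongInduction with
  | H S ih =>
  rcases S.eq_empty_or_nonempty with rfl | hne
  · simp
  obtain ⟨a, haS, hamin⟩ : ∃ a ∈ S, ∀ e ∈ S, ¬ r e a := by
    have hwf := S.finite_toSet.wellFoundedOn (r := r)
    obtain ⟨b, hb⟩ := hne
    obtain ⟨a, -, ha⟩ := hwf.has_min Set.univ ⟨⟨b, hb⟩, trivial⟩
    exact ⟨a.1, a.2, fun e he => ha ⟨e, he⟩ trivial⟩
  set S' := S.erase a with hS'
  set U := S.filter fun z => r a z with hU
  have haS' : a ∉ S' := by simp [hS']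
  have hSi : S = insert a S' := (Finset.insert_erase haS).symm
  have hUS' : U ⊆ S' := by
    intro z hz
    simp only [hU, Finset.mem_filter] at hz
    refine Finset.mem_erase.2 ⟨?_, hz.1⟩
    rintro rfl
    exact irrefl_of r z hz.2
  have ih1 := ih S' (Finset.erase_ssubset haS)
  have ih2 := ih U ((Finset.ssubset_iff_of_subset (hUS'.trans (Finset.erase_subset _ _))).2
    ⟨a, haS, fun h => haS' (hUS' h)⟩)
  have hd' : ∀ e ∈ S, above r S e = above r S' e := by
    intro e he
    unfold above
    congr 1
    ext z
    simp only [Finset.mem_filter, hS', Finset.mem_erase]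
    constructor
    · rintro ⟨h1, h2⟩
      refine ⟨⟨?_, h1⟩, h2⟩
      rintro rfl
      exact hamin e he h2
    · rintro ⟨⟨_, h1⟩, h2⟩
      exact ⟨h1, h2⟩
  have hdU : ∀ e ∈ U, above r S' e = above r U e := by
    intro e he
    have he2 := (Finset.mem_filter.1 he)
    rw [← hd' e he2.1]
    unfold above
    congr 1
    ext z
    simp only [Finset.mem_filter, hU]
    constructor
    · rintro ⟨h1, h2⟩
      exact ⟨⟨h1, trans_of r he2.2 h2⟩, h2⟩
    · rintro ⟨⟨h1, _⟩, h2⟩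
      exact ⟨h1, h2⟩
  have hw : ∀ l, hookRatio r S l =
      (if r a l then ((above r S a : ℝ) + 1) / above r S a else 1) * hookRatio r S' l := by
    intro l
    unfold hookRatio
    conv_lhs => rw [hSi, Finset.prod_insert haS', ← hSi]
    congr 1
    refine Finset.prod_congr rfl fun e he => ?_
    rw [hd' e (Finset.mem_of_mem_erase he)]
  -- `U` is closed upwards, so its elements keep their hook lengths; the elements of `S'` outside
  -- `U` only contribute factors at least one.
  have hwU : ∀ l ∈ U, hookRatio r U l ≤ hookRatio r S' l := by
    intro l hl
    have h1 : hookRatio r U l =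
        ∏ e ∈ U, if r e l then ((above r S' e : ℝ) + 1) / above r S' e else 1 :=
      Finset.prod_congr rfl fun e he => by rw [hdU e he]
    rw [h1, hookRatio, ← Finset.prod_sdiff hUS']
    refine le_mul_of_one_le_left (Finset.prod_nonneg fun e _ => ?_) ?_
    · split_ifs <;> positivity
    · refine Finset.prod_induction _ (fun x : ℝ => 1 ≤ x)
        (fun _ _ h h' => one_le_mul_of_one_le_of_one_le h h') le_rfl fun e _ => ?_
      split_ifs with h2
      · exact one_le_hookFactor (hUS' hl) h2
      · rfl
  -- If nothing lies above `a`, then `a` is itself maximal and supplies the missing summand `1`.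
  -- Otherwise the maximal elements are unchanged, and each one above `a` gains the factor `1 + 1 /
  -- |U|`.
  by_cases hUe : U = ∅
  · have hmax : (S.filter fun l => ∀ z ∈ S, ¬ r l z) =
        insert a (S'.filter fun l => ∀ z ∈ S', ¬ r l z) := by
      ext l
      simp only [Finset.mem_filter, Finset.mem_insert]
      constructor
      · rintro ⟨h1, h2⟩
        by_cases hla : l = a
        · exact Or.inl hla
        · exact Or.inr ⟨Finset.mem_erase.2 ⟨hla, h1⟩, fun z hz => h2 z (Finset.mem_of_mem_erase hz)⟩
      · rintro (rfl | ⟨h1, h2⟩)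
        · refine ⟨haS, fun z hz hr => ?_⟩
          have : z ∈ U := Finset.mem_filter.2 ⟨hz, hr⟩
          simp [hUe] at this
        · have hlS := Finset.mem_of_mem_erase h1
          refine ⟨hlS, fun z hz hr => ?_⟩
          by_cases hza : z = a
          · exact hamin l hlS (hza ▸ hr)
          · exact h2 z (Finset.mem_erase.2 ⟨hza, hz⟩) hr
    rw [hmax, Finset.sum_insert (by simp [haS'])]
    have h1 : hookRatio r S a = 1 :=
      Finset.prod_eq_one fun e he => by simp [hamin e he]
    have h2 : ∀ l ∈ S'.filter (fun l => ∀ z ∈ S', ¬ r l z), hookRatio r S l = hookRatio r S' l := by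
      intro l hl
      have hlS : l ∈ S := Finset.mem_of_mem_erase (Finset.mem_filter.1 hl).1
      rw [hw, if_neg, one_mul]
      intro hr
      have : l ∈ U := Finset.mem_filter.2 ⟨hlS, hr⟩
      simp [hUe] at this
    rw [h1, Finset.sum_congr rfl h2]
    have h3 : S.card = S'.card + 1 := by rw [hSi, Finset.card_insert_of_notMem haS']
    rw [h3]
    push_cast
    linarith
  · obtain ⟨b, hb⟩ := Finset.nonempty_iff_ne_empty.2 hUe
    have hb' := Finset.mem_filter.1 hb
    have hmax : (S.filter fun l => ∀ z ∈ S, ¬ r l z) =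
        (S'.filter fun l => ∀ z ∈ S', ¬ r l z) := by
      ext l
      simp only [Finset.mem_filter]
      constructor
      · rintro ⟨h1, h2⟩
        refine ⟨Finset.mem_erase.2 ⟨?_, h1⟩, fun z hz => h2 z (Finset.mem_of_mem_erase hz)⟩
        rintro rfl
        exact h2 b hb'.1 hb'.2
      · rintro ⟨h1, h2⟩
        have hlS := Finset.mem_of_mem_erase h1
        refine ⟨hlS, fun z hz hr => ?_⟩
        by_cases hza : z = a
        · exact hamin l hlS (hza ▸ hr)
        · exact h2 z (Finset.mem_erase.2 ⟨hza, hz⟩) hr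
    have hpos : (0 : ℝ) < above r S a := by exact_mod_cast above_pos hb'.1 hb'.2
    have hUc : (U.card : ℝ) = above r S a := rfl
    have hmaxU : (U.filter fun l => ∀ z ∈ U, ¬ r l z) =
        (S'.filter fun l => ∀ z ∈ S', ¬ r l z).filter fun l => r a l := by
      rw [← hmax]
      ext l
      simp only [Finset.mem_filter, hU]
      constructor
      · rintro ⟨⟨h1, h2⟩, h3⟩
        exact ⟨⟨h1, fun z hz hr => h3 z ⟨hz, trans_of r h2 hr⟩ hr⟩, h2⟩
      · rintro ⟨⟨h1, h2⟩, h3⟩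
        exact ⟨⟨h1, h3⟩, fun z hz => h2 z hz.1⟩
    have h5 : ∀ l, hookRatio r S l = hookRatio r S' l +
        (if r a l then hookRatio r S' l / above r S a else 0) := by
      intro l
      rw [hw]
      split_ifs
      · field_simp
      · ring
    rw [hmax, Finset.sum_congr rfl (fun l _ => h5 l), Finset.sum_add_distrib, ← Finset.sum_filter,
      ← hmaxU, ← Finset.sum_div]
    have h6 : (U.card : ℝ) ≤ ∑ l ∈ U with ∀ z ∈ U, ¬ r l z, hookRatio r S' l :=
      ih2.trans (Finset.sum_le_sum fun l hl => hwU l (Finset.mem_filter.1 hl).1)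
    -- The total gain is at least `|U| / |U| = 1`, by the induction hypothesis for `U`.
    have h7 : 1 ≤ (∑ l ∈ U with ∀ z ∈ U, ¬ r l z, hookRatio r S' l) / above r S a := by
      rw [le_div_iff₀ hpos, one_mul, ← hUc]
      exact h6
    have h3 : S.card = S'.card + 1 := by rw [hSi, Finset.card_insert_of_notMem haS']
    rw [h3]
    push_cast
    linarith

open Classical in
theorem hookWeight_erase {α : Type*} (r : α → α → Prop) [IsStrictOrder α r] {S : Finset α} {l : α}
    (hl : l ∈ S) (hmax : ∀ z ∈ S, ¬ r l z) :
    hookWeight r (S.erase l) = hookWeight r S * hookRatio r S l := by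
  unfold hookWeight hookRatio
  rw [← Finset.prod_mul_distrib, ← Finset.mul_prod_erase S _ hl]
  have h0 : above r S l = 0 := by
    unfold above
    rw [Finset.card_eq_zero, Finset.filter_eq_empty_iff]
    exact fun z hz => hmax z hz
  rw [h0, if_neg (irrefl_of r l)]
  simp only [Nat.cast_zero, zero_add, inv_one, one_mul]
  refine Finset.prod_congr rfl fun e he => ?_
  have heS := Finset.mem_of_mem_erase he
  split_ifs with h
  · have h1 : above r S e = above r (S.erase l) e + 1 := by
      unfold above
      rw [Finset.filter_erase, Finset.card_erase_add_one]
      simp [hl, h]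
    rw [h1]
    push_cast
    have : ((above r (S.erase l) e : ℝ) + 1) ≠ 0 := by positivity
    have : ((above r (S.erase l) e : ℝ) + 1 + 1) ≠ 0 := by positivity
    field_simp
  · have h1 : above r (S.erase l) e = above r S e := by
      unfold above
      rw [Finset.filter_erase, Finset.erase_eq_of_notMem]
      simp [h]
    rw [h1, mul_one]

open Classical in
/-- The inequality behind the hook length bound: the weight `n! * hookWeight` is at most the sum of
its values after removing one maximal element. -/
theorem card_mul_hookWeight_le {α : Type*} (r : α → α → Prop) [IsStrictOrder α r] (S : Finset α) :
    S.card * hookWeight r S ≤ ∑ l ∈ S with ∀ z ∈ S, ¬ r l z, hookWeight r (S.erase l) := by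
  have h0 : 0 ≤ hookWeight r S := Finset.prod_nonneg fun e _ => by positivity
  rw [Finset.sum_congr rfl fun l hl => hookWeight_erase r (Finset.mem_filter.1 hl).1
    (Finset.mem_filter.1 hl).2, ← Finset.mul_sum, mul_comm]
  exact mul_le_mul_of_nonneg_left (card_le_sum_hookRatio r S) h0

/-! ### Hilbert-Schmidt norm, iterated commutators and imaginary-time evolution -/

section Spectral
variable {d : Type*} [Fintype d]

/-- The square of the Hilbert-Schmidt norm. -/
def hsSq (M : Matrix d d ℂ) : ℝ := ∑ i, ∑ j, ‖M i j‖ ^ 2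

theorem hsSq_eq_trace (M : Matrix d d ℂ) : (hsSq M : ℂ) = (M.conjTranspose * M).trace := by
  simp only [hsSq, Matrix.trace, Matrix.diag, Matrix.mul_apply, Matrix.conjTranspose_apply]
  rw [Finset.sum_comm]
  push_cast
  refine Finset.sum_congr rfl fun i _ => Finset.sum_congr rfl fun j _ => ?_
  rw [← Complex.conj_mul']
  rfl

variable [DecidableEq d]

theorem hsSq_conj (U M : Matrix d d ℂ) (h : U.conjTranspose * U = 1) :
    hsSq (U * M * U.conjTranspose) = hsSq M := by
  have : (hsSq (U * M * U.conjTranspose) : ℂ) = hsSq M := by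
    rw [hsSq_eq_trace, hsSq_eq_trace]
    simp only [Matrix.conjTranspose_mul, Matrix.conjTranspose_conjTranspose]
    have : U * (M.conjTranspose * U.conjTranspose) * (U * M * U.conjTranspose) =
        U * (M.conjTranspose * (U.conjTranspose * U) * M * U.conjTranspose) := by
      simp only [Matrix.mul_assoc]
    rw [this, Matrix.trace_mul_comm, h, Matrix.mul_one, Matrix.mul_assoc, h, Matrix.mul_one]
  exact_mod_cast this

/-- Each column is the image of a unit vector, hence has norm at most `‖M‖`. -/
theorem hsSq_le (M : Matrix d d ℂ) : hsSq M ≤ Fintype.card d * ‖M‖ ^ 2 := by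
  have h : ∀ j, ∑ i, ‖M i j‖ ^ 2 ≤ ‖M‖ ^ 2 := by
    intro j
    have h1 := Matrix.l2_opNorm_mulVec M (EuclideanSpace.single j (1 : ℂ))
    have h2 : ‖EuclideanSpace.single j (1 : ℂ)‖ = 1 := by simp
    rw [h2, mul_one] at h1
    have h3 := pow_le_pow_left₀ (norm_nonneg _) h1 2
    rw [EuclideanSpace.norm_sq_eq] at h3
    refine le_trans (le_of_eq ?_) h3
    refine Finset.sum_congr rfl fun i _ => ?_
    simp
  unfold hsSq
  rw [Finset.sum_comm]
  calc ∑ j, ∑ i, ‖M i j‖ ^ 2 ≤ ∑ j : d, ‖M‖ ^ 2 := Finset.sum_le_sum fun j _ => h j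
    _ = _ := by simp

/-- The commutator with `H`. -/
def comm (H M : Matrix d d ℂ) : Matrix d d ℂ := H * M - M * H

theorem pow_div_factorial_le_cosh (x : ℝ) (n : ℕ) :
    x ^ (2 * n) / (2 * n).factorial ≤ Real.cosh x := by
  have h := Real.hasSum_cosh x
  rw [← h.tsum_eq]
  refine h.summable.le_tsum n fun k _ => ?_
  have : 0 ≤ x ^ (2 * k) := by rw [pow_mul]; positivity
  positivity

theorem comm_conj (U D M : Matrix d d ℂ) (h : U.conjTranspose * U = 1) :
    comm (U * D * U.conjTranspose) (U * M * U.conjTranspose) =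
      U * comm D M * U.conjTranspose := by
  have key : ∀ P Q : Matrix d d ℂ, (U * P * U.conjTranspose) * (U * Q * U.conjTranspose) =
      U * (P * Q) * U.conjTranspose := by
    intro P Q
    have : (U * P * U.conjTranspose) * (U * Q * U.conjTranspose) =
      U * (P * (U.conjTranspose * U) * Q) * U.conjTranspose := by simp only [Matrix.mul_assoc]
    rw [this, h, Matrix.mul_one]
  unfold comm
  rw [key, key, Matrix.mul_sub, Matrix.sub_mul]

theorem iterate_comm_conj (U D M : Matrix d d ℂ) (h : U.conjTranspose * U = 1) (n : ℕ) :
    (comm (U * D * U.conjTranspose))^[n] (U * M * U.conjTranspose) =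
      U * (comm D)^[n] M * U.conjTranspose := by
  induction n with
  | zero => rfl
  | succ n ih => rw [Function.iterate_succ_apply', ih, comm_conj _ _ _ h,
      Function.iterate_succ_apply']

theorem iterate_comm_diagonal (l : d → ℂ) (M : Matrix d d ℂ) (n : ℕ) (i j : d) :
    (comm (Matrix.diagonal l))^[n] M i j = (l i - l j) ^ n * M i j := by
  induction n generalizing i j with
  | zero => simp
  | succ n ih =>
    rw [Function.iterate_succ_apply', comm, Matrix.sub_apply, Matrix.diagonal_mul,
      Matrix.mul_diagonal, ih]
    ring

/-- For diagonal `H` both sides are weighted sums of `‖B i j‖ ^ 2`. The weights on the right may be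
symmetrized to `cosh (2t(l i - l j))`, and those on the left are one term of its series. -/
theorem hsSq_diagonal_evolution (l : d → ℝ) (B : Matrix d d ℂ) (hB : B.IsHermitian) (t : ℝ)
    (n : ℕ) :
    (2 * t) ^ (2 * n) / (2 * n).factorial *
        hsSq ((comm (Matrix.diagonal fun i => (l i : ℂ)))^[n] B) ≤
      hsSq (Matrix.diagonal (fun i => Complex.exp (t * l i)) * B *
        Matrix.diagonal (fun i => Complex.exp (-(t * l i)))) := by
  have hsym : ∀ i j, ‖B i j‖ = ‖B j i‖ := by
    intro i j
    rw [← hB.apply i j, norm_star]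
  have hR : hsSq (Matrix.diagonal (fun i => Complex.exp (t * l i)) * B *
        Matrix.diagonal (fun i => Complex.exp (-(t * l i)))) =
      ∑ i, ∑ j, Real.exp (2 * t * (l i - l j)) * ‖B i j‖ ^ 2 := by
    unfold hsSq
    refine Finset.sum_congr rfl fun i _ => Finset.sum_congr rfl fun j _ => ?_
    rw [Matrix.mul_diagonal, Matrix.diagonal_mul, norm_mul, norm_mul, Complex.norm_exp,
      Complex.norm_exp, mul_pow, mul_pow, ← Real.exp_nat_mul, ← Real.exp_nat_mul]
    have h1 : (↑t * ↑(l i) : ℂ).re = t * l i := by simp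
    have h2 : (-(↑t * ↑(l j)) : ℂ).re = -(t * l j) := by simp
    rw [h1, h2, mul_right_comm, ← Real.exp_add]
    congr 2
    push_cast
    ring
  have hL : hsSq ((comm (Matrix.diagonal fun i => (l i : ℂ)))^[n] B) =
      ∑ i, ∑ j, (l i - l j) ^ (2 * n) * ‖B i j‖ ^ 2 := by
    unfold hsSq
    refine Finset.sum_congr rfl fun i _ => Finset.sum_congr rfl fun j _ => ?_
    rw [iterate_comm_diagonal, norm_mul, mul_pow, norm_pow, ← Complex.ofReal_sub,
      Complex.norm_real, ← pow_mul, mul_comm n 2, pow_mul, pow_mul, Real.norm_eq_abs, sq_abs]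
  -- Exchanging `i` and `j` reverses the exponent and keeps `‖B i j‖`, so the odd part of the
  -- exponential cancels.
  have hcosh : ∑ i, ∑ j, Real.exp (2 * t * (l i - l j)) * ‖B i j‖ ^ 2 =
      ∑ i, ∑ j, Real.cosh (2 * t * (l i - l j)) * ‖B i j‖ ^ 2 := by
    have h1 : ∑ i, ∑ j, Real.exp (2 * t * (l i - l j)) * ‖B i j‖ ^ 2 =
        ∑ i, ∑ j, Real.exp (-(2 * t * (l i - l j))) * ‖B i j‖ ^ 2 := by
      rw [Finset.sum_comm]
      refine Finset.sum_congr rfl fun i _ => Finset.sum_congr rfl fun j _ => ?_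
      rw [hsym j i]
      congr 2
      ring
    have h2 : ∑ i, ∑ j, Real.cosh (2 * t * (l i - l j)) * ‖B i j‖ ^ 2 =
        (∑ i, ∑ j, Real.exp (2 * t * (l i - l j)) * ‖B i j‖ ^ 2 +
        ∑ i, ∑ j, Real.exp (-(2 * t * (l i - l j))) * ‖B i j‖ ^ 2) / 2 := by
      rw [← Finset.sum_add_distrib, Finset.sum_div]
      refine Finset.sum_congr rfl fun i _ => ?_
      rw [← Finset.sum_add_distrib, Finset.sum_div]
      refine Finset.sum_congr rfl fun j _ => ?_
      rw [Real.cosh_eq]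
      ring
    rw [h2, ← h1]
    ring
  rw [hR, hL, hcosh, Finset.mul_sum]
  refine Finset.sum_le_sum fun i _ => ?_
  rw [Finset.mul_sum]
  refine Finset.sum_le_sum fun j _ => ?_
  rw [← mul_assoc]
  refine mul_le_mul_of_nonneg_right ?_ (by positivity)
  refine le_trans (le_of_eq ?_) (pow_div_factorial_le_cosh (2 * t * (l i - l j)) n)
  rw [mul_pow _ (l i - l j)]
  ring

/-- In imaginary time, each term of the commutator expansion bounds the evolution from below. -/
theorem hsSq_comm_le_evolution (H A : Matrix d d ℂ) (hH : H.IsHermitian) (hA : A.IsHermitian)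
    (t : ℝ) (n : ℕ) :
    (2 * t) ^ (2 * n) / (2 * n).factorial * hsSq ((comm H)^[n] A) ≤
      Fintype.card d *
        ‖NormedSpace.exp ((t : ℂ) • H) * A * NormedSpace.exp (-((t : ℂ) • H))‖ ^ 2 := by
  refine le_trans ?_ (hsSq_le _)
  set U : Matrix d d ℂ := (hH.eigenvectorUnitary : Matrix d d ℂ) with hU
  have hUU : U.conjTranspose * U = 1 := Unitary.coe_star_mul_self hH.eigenvectorUnitary
  have hUU' : U * U.conjTranspose = 1 := Unitary.coe_mul_star_self hH.eigenvectorUnitary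
  set D : Matrix d d ℂ := Matrix.diagonal fun i => (hH.eigenvalues i : ℂ) with hD
  set B := U.conjTranspose * A * U with hBdef
  have hHD : H = U * D * U.conjTranspose := by
    have := hH.spectral_theorem
    rw [Unitary.conjStarAlgAut_apply] at this
    exact this
  have hAB : A = U * B * U.conjTranspose := by
    have : U * B * U.conjTranspose = (U * U.conjTranspose) * A * (U * U.conjTranspose) := by
      simp only [hBdef, Matrix.mul_assoc]
    rw [this, hUU', Matrix.one_mul, Matrix.mul_one]
  have hB : B.IsHermitian := by
    have := Matrix.isHermitian_conjTranspose_mul_mul U hA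
    exact this
  have hinv : U⁻¹ = U.conjTranspose := Matrix.inv_eq_left_inv hUU
  have hUunit : IsUnit U := ⟨⟨U, U.conjTranspose, hUU', hUU⟩, rfl⟩
  have hexp : ∀ s : ℂ, NormedSpace.exp (s • H) =
      U * Matrix.diagonal (fun i => Complex.exp (s * hH.eigenvalues i)) * U.conjTranspose := by
    intro s
    have h1 : s • H = U * (Matrix.diagonal fun i => s * (hH.eigenvalues i : ℂ)) * U⁻¹ := by
      rw [hinv]
      conv_lhs => rw [hHD, ← Matrix.smul_mul, ← Matrix.mul_smul, hD, ← Matrix.diagonal_smul]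
      rfl
    rw [h1, Matrix.exp_conj _ _ hUunit, Matrix.exp_diagonal, hinv]
    congr 3
    ext i
    rw [Pi.exp_def, Complex.exp_eq_exp_ℂ]
  have hX : NormedSpace.exp ((t : ℂ) • H) * A * NormedSpace.exp (-((t : ℂ) • H)) =
      U * (Matrix.diagonal (fun i => Complex.exp (t * hH.eigenvalues i)) * B *
        Matrix.diagonal (fun i => Complex.exp (-(t * hH.eigenvalues i)))) * U.conjTranspose := by
    rw [← neg_smul, hexp, hexp, hBdef]
    simp only [Matrix.mul_assoc, neg_mul]
  rw [hX, hsSq_conj _ _ hUU]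
  have hc : (comm H)^[n] A = U * (comm D)^[n] B * U.conjTranspose := by
    rw [← iterate_comm_conj _ _ _ hUU, ← hHD, ← hAB]
  rw [hc, hsSq_conj _ _ hUU]
  exact hsSq_diagonal_evolution _ _ hB _ _

end Spectral

/-! ### Pauli coefficients -/

/-- The pairing of `ℤ/2` with itself with values `±1`. -/
def eps (a b : Fin 2) : ℤ := if a = 1 ∧ b = 1 then -1 else 1

theorem eps_add_left : ∀ a a' b : Fin 2, eps (a + a') b = eps a b * eps a' b := by decide

theorem eps_add_right : ∀ a b b' : Fin 2, eps a (b + b') = eps a b * eps a b' := by decide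

theorem eps_zero_left : ∀ b : Fin 2, eps 0 b = 1 := by decide

theorem eps_zero_right : ∀ b : Fin 2, eps b 0 = 1 := by decide

theorem fin2_add_self : ∀ a : Fin 2, a + a = 0 := by decide

/-- The indicator function of a finite set of sites, modulo two. -/
def ind (V : Finset Site) (x : Site) : Fin 2 := if x ∈ V then 1 else 0

/-- The indicator function of a site, modulo two. -/
def delta (y x : Site) : Fin 2 := if x = y then 1 else 0

/-- Restriction of a function on the lattice to a configuration in `L`. -/
def res (L : Finset Site) (u : Site → Fin 2) : {x // x ∈ L} → Fin 2 := fun x => u x.1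

/-- The character of the group of configurations given by `u`. -/
def chi {L : Finset Site} (u : Site → Fin 2) (s : {x // x ∈ L} → Fin 2) : ℤ :=
  ∏ x, eps (u x.1) (s x)

section
variable {L : Finset Site}

theorem chi_add_left (u v : Site → Fin 2) (s : {x // x ∈ L} → Fin 2) :
    chi (u + v) s = chi u s * chi v s := by
  simp only [chi, Pi.add_apply, eps_add_left, Finset.prod_mul_distrib]

theorem chi_add_right (u : Site → Fin 2) (s t : {x // x ∈ L} → Fin 2) :
    chi u (s + t) = chi u s * chi u t := by
  simp only [chi, Pi.add_apply, eps_add_right, Finset.prod_mul_distrib]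

theorem chi_delta_right (u : Site → Fin 2) {y : Site} (hy : y ∈ L) :
    chi u (res L (delta y)) = eps (u y) 1 := by
  rw [chi, Finset.prod_eq_single ⟨y, hy⟩]
  · simp [res, delta]
  · intro b _ hb
    have : b.1 ≠ y := fun h => hb (Subtype.ext h)
    simp [res, delta, this, eps_zero_right]
  · simp

theorem chi_delta_left {x : Site} (hx : x ∈ L) (s : {x // x ∈ L} → Fin 2) :
    chi (delta x) s = eps 1 (s ⟨x, hx⟩) := by
  rw [chi, Finset.prod_eq_single ⟨x, hx⟩]
  · simp [delta]
  · intro b _ hb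
    have : b.1 ≠ x := fun h => hb (Subtype.ext h)
    simp [delta, this, eps_zero_left]
  · simp

theorem chi_delta_delta {x y : Site} (h : x ≠ y) : chi (delta x) (res L (delta y)) = 1 := by
  refine Finset.prod_eq_one fun b _ => ?_
  by_cases hb : b.1 = x
  · have : b.1 ≠ y := fun h' => h (hb.symm.trans h')
    simp [res, delta, this, eps_zero_right]
  · simp [delta, hb, eps_zero_left]

theorem add_add_self (s t : {x // x ∈ L} → Fin 2) : s + t + t = s := by
  ext x
  simp [add_assoc, fin2_add_self]

/-- The Pauli operator `σ₃` at `x` times `σ₁` at `y`. -/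
def edgeOp (L : Finset Site) (x y : Site) : Obs L :=
  Matrix.of fun s t => if t = s + res L (delta y) then (chi (delta x) s : ℂ) else 0

/-- The coefficient (not normalized) of an operator at the Pauli string with `σ₃` exponents `u` and
`σ₁` exponents `w`. -/
def coef (u w : Site → Fin 2) (M : Obs L) : ℂ := ∑ s, (chi u s : ℂ) * M s (s + res L w)

theorem coef_sum {ι : Type*} (S : Finset ι) (u w : Site → Fin 2) (M : ι → Obs L) :
    coef u w (∑ i ∈ S, M i) = ∑ i ∈ S, coef u w (M i) := by
  simp only [coef, Matrix.sum_apply, Finset.mul_sum]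
  rw [Finset.sum_comm]

theorem edgeOp_mul_apply (x y : Site) (M : Obs L) (s t : {x // x ∈ L} → Fin 2) :
    (edgeOp L x y * M) s t = chi (delta x) s * M (s + res L (delta y)) t := by
  rw [Matrix.mul_apply, Finset.sum_eq_single (s + res L (delta y))]
  · simp [edgeOp]
  · intro b _ hb
    simp [edgeOp, hb]
  · simp

theorem mul_edgeOp_apply {x y : Site} (h : x ≠ y) (M : Obs L) (s t : {x // x ∈ L} → Fin 2) :
    (M * edgeOp L x y) s t = chi (delta x) t * M s (t + res L (delta y)) := by
  rw [Matrix.mul_apply, Finset.sum_eq_single (t + res L (delta y))]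
  · simp [edgeOp, add_add_self, chi_add_right, chi_delta_delta h, mul_comm]
  · intro b _ hb
    have : t ≠ b + res L (delta y) := by
      rintro rfl
      exact hb (add_add_self _ _).symm
    simp [edgeOp, this]
  · simp

/-- Left and right multiplication by an edge operator shift the Pauli string in the same way and
differ only by a sign. The integer factor is `0` if the edge operator commutes with the string and
`±2` otherwise. -/
theorem coef_comm_edgeOp (u w : Site → Fin 2) {x y : Site} (h : x ≠ y) (M : Obs L) :
    coef u w (comm (edgeOp L x y) M) =
      ((chi u (res L (delta y)) - chi (delta x) (res L w) : ℤ) : ℂ) *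
        coef (u + delta x) (w + delta y) M := by
  have hw : res L (w + delta y) = res L w + res L (delta y) := rfl
  have h1 : ∑ s, (chi u s : ℂ) * (edgeOp L x y * M) s (s + res L w) =
      chi u (res L (delta y)) * coef (u + delta x) (w + delta y) M := by
    rw [← Equiv.sum_comp (Equiv.addRight (res L (delta y))), coef, Finset.mul_sum]
    refine Finset.sum_congr rfl fun s _ => ?_
    simp only [Equiv.coe_addRight]
    rw [edgeOp_mul_apply, add_add_self, hw, chi_add_right, chi_add_right, chi_delta_delta h,
      chi_add_left, add_right_comm, add_assoc]
    push_cast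
    ring
  have h2 : ∑ s, (chi u s : ℂ) * (M * edgeOp L x y) s (s + res L w) =
      chi (delta x) (res L w) * coef (u + delta x) (w + delta y) M := by
    rw [coef, Finset.mul_sum]
    refine Finset.sum_congr rfl fun s _ => ?_
    rw [mul_edgeOp_apply h, hw, chi_add_right, chi_add_left, add_assoc]
    push_cast
    ring
  rw [coef]
  simp only [comm, Matrix.sub_apply, mul_sub, Finset.sum_sub_distrib]
  rw [h1, h2]
  push_cast
  ring

/-- Cauchy-Schwarz: a coefficient is a signed sum of `2 ^ L.card` distinct entries of `M`. -/
theorem norm_coef_sq_le (u w : Site → Fin 2) (M : Obs L) :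
    ‖coef u w M‖ ^ 2 ≤ 2 ^ L.card * hsSq M := by
  have hc : (Finset.univ : Finset ({x // x ∈ L} → Fin 2)).card = 2 ^ L.card := by
    simp
  have h1 : ‖coef u w M‖ ≤ ∑ s, ‖M s (s + res L w)‖ := by
    refine (norm_sum_le _ _).trans (Finset.sum_le_sum fun s _ => ?_)
    rw [norm_mul]
    have : ‖(chi u s : ℂ)‖ = 1 := by
      rw [Complex.norm_intCast]
      have h : |chi u s| = 1 := by
        rw [chi, Finset.abs_prod]
        refine Finset.prod_eq_one fun x _ => ?_
        have : ∀ a b : Fin 2, |eps a b| = 1 := by decide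
        exact this _ _
      exact_mod_cast h
    rw [this, one_mul]
  calc ‖coef u w M‖ ^ 2 ≤ (∑ s, ‖M s (s + res L w)‖) ^ 2 := by gcongr
    _ ≤ (Finset.univ : Finset ({x // x ∈ L} → Fin 2)).card * ∑ s, ‖M s (s + res L w)‖ ^ 2 :=
        sq_sum_le_card_mul_sum_sq
    _ ≤ 2 ^ L.card * hsSq M := by
        rw [hc]
        push_cast
        gcongr
        refine Finset.sum_le_sum fun s _ => ?_
        exact Finset.single_le_sum (f := fun t => ‖M s t‖ ^ 2) (fun t _ => by positivity)
          (Finset.mem_univ _)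

/-- `y` is the right or lower neighbour of `x`. -/
def IsEdge (x y : Site) : Prop := y = x + (1, 0) ∨ y = x - (0, 1)

open Classical in
/-- The edges of the directed lattice in the region `L`. -/
def edges (L : Finset Site) : Finset (Site × Site) := (L ×ˢ L).filter fun e => IsEdge e.1 e.2

theorem IsEdge.ne {x y : Site} (h : IsEdge x y) : x ≠ y := by
  rintro rfl
  rcases h with h | h
  · have := congrArg Prod.fst h
    simp at this
  · have := congrArg Prod.snd h
    simp at this
    omega

theorem mem_edges {L : Finset Site} {x y : Site} :
    (x, y) ∈ edges L ↔ x ∈ L ∧ y ∈ L ∧ IsEdge x y := by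
  simp [edges, and_assoc]

/-- The Hamiltonian as a sum of Pauli operators over the edges. -/
def edgeSum (L : Finset Site) : Obs L := ∑ e ∈ edges L, edgeOp L e.1 e.2

theorem coef_comm_edgeSum (u w : Site → Fin 2) (M : Obs L) :
    coef u w (comm (edgeSum L) M) = ∑ e ∈ edges L,
      ((chi u (res L (delta e.2)) - chi (delta e.1) (res L w) : ℤ) : ℂ) *
        coef (u + delta e.1) (w + delta e.2) M := by
  have : comm (edgeSum L) M = ∑ e ∈ edges L, comm (edgeOp L e.1 e.2) M := by
    simp only [comm, edgeSum, Finset.sum_mul, Finset.mul_sum, Finset.sum_sub_distrib]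
  rw [this, coef_sum]
  exact Finset.sum_congr rfl fun e he => coef_comm_edgeOp u w (mem_edges.1 he).2.2.ne M

/-- `σ₁` at the origin. -/
def flipOp (L : Finset Site) : Obs L :=
  Matrix.of fun s t => if t = s + res L (delta 0) then 1 else 0

theorem coef_flipOp_of_ne {u w : Site → Fin 2} (h : res L w ≠ res L (delta 0)) :
    coef u w (flipOp L) = 0 := by
  refine Finset.sum_eq_zero fun s _ => ?_
  simp [flipOp, h]

theorem coef_flipOp_zero : coef 0 (delta 0) (flipOp L) = 2 ^ L.card := by
  have : ∀ s : {x // x ∈ L} → Fin 2, chi (0 : Site → Fin 2) s = 1 := fun s =>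
    Finset.prod_eq_one fun x _ => eps_zero_left _
  simp [coef, flipOp, this]

/-- Flipping the configuration at `x` changes the sign of the character and leaves the entries of
`flipOp` alone, so the sum equals its own negative. -/
theorem coef_flipOp_of_ne_zero {u : Site → Fin 2} (w : Site → Fin 2) {x : Site} (hx : x ∈ L)
    (h : u x ≠ 0) : coef u w (flipOp L) = 0 := by
  have hu : u x = 1 := by
    have : ∀ a : Fin 2, a ≠ 0 → a = 1 := by decide
    exact this _ h
  have h1 : coef u w (flipOp L) = - coef u w (flipOp L) := by
    conv_lhs => rw [coef, ← Equiv.sum_comp (Equiv.addRight (res L (delta x)))]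
    rw [coef, ← Finset.sum_neg_distrib]
    refine Finset.sum_congr rfl fun s _ => ?_
    simp only [Equiv.coe_addRight, chi_add_right, chi_delta_right u hx, hu]
    have h2 : flipOp L (s + res L (delta x)) (s + res L (delta x) + res L w) =
        flipOp L s (s + res L w) := by
      simp [flipOp]
    rw [h2]
    simp [eps]
  exact self_eq_neg.1 h1

end

/-! ### Growth of a tree -/

theorem ind_add_delta (V : Finset Site) (y : Site) :
    ind V + delta y = ind (symmDiff V {y}) := by
  ext x : 1
  by_cases h1 : x ∈ V <;> by_cases h2 : x = y <;>
    simp [ind, delta, Finset.mem_symmDiff, h1, h2] <;> subst h2 <;> simp [h1]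

/-- Each commutator with an edge flips the `σ₁` exponent at one site only, the head of the edge, so
`n` of them cannot reach more than `n` sites. -/
theorem coef_iterate_eq_zero {L : Finset Site} (n : ℕ) (u : Site → Fin 2) (V : Finset Site)
    (hV : V ⊆ L) (hn : n < V.card) :
    coef u (delta 0 + ind V) ((comm (edgeSum L))^[n] (flipOp L)) = 0 := by
  induction n generalizing u V with
  | zero =>
    obtain ⟨v, hv⟩ := Finset.card_pos.1 hn
    refine coef_flipOp_of_ne fun h => ?_
    have := congrFun h ⟨v, hV hv⟩
    simp [res, ind, hv] at this
  | succ n ih =>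
    rw [Function.iterate_succ_apply', coef_comm_edgeSum]
    refine Finset.sum_eq_zero fun e he => ?_
    have he' := mem_edges.1 he
    rw [add_assoc, ind_add_delta, ih, mul_zero]
    · intro z hz
      rcases Finset.mem_symmDiff.1 hz with h | h
      · exact hV h.1
      · rw [Finset.mem_singleton.1 h.1]
        exact he'.2.1
    · have h1 : V.erase e.2 ⊆ symmDiff V {e.2} := by
        intro z hz
        simp only [Finset.mem_erase] at hz
        simp [Finset.mem_symmDiff, hz]
      have h2 := Finset.card_le_card h1
      have h3 := Finset.pred_card_le_card_erase (s := V) (a := e.2)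
      omega

/-- At the critical order no commutator can be wasted: the last edge must have its head in `V`,
since otherwise the remaining `n` would have to flip more than `n` sites. -/
theorem coef_iterate_succ {L : Finset Site} {n : ℕ} (u : Site → Fin 2) {V : Finset Site}
    (hV : V ⊆ L) (hn : V.card = n + 1) :
    coef u (delta 0 + ind V) ((comm (edgeSum L))^[n + 1] (flipOp L)) =
      ∑ e ∈ edges L with e.2 ∈ V,
        ((chi u (res L (delta e.2)) - chi (delta e.1) (res L (delta 0 + ind V)) : ℤ) : ℂ) *
          coef (u + delta e.1) (delta 0 + ind (V.erase e.2))
            ((comm (edgeSum L))^[n] (flipOp L)) := by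
  rw [Function.iterate_succ_apply', coef_comm_edgeSum, Finset.sum_filter]
  refine Finset.sum_congr rfl fun e he => ?_
  have he' := mem_edges.1 he
  rw [add_assoc, ind_add_delta]
  split_ifs with h
  · have hs : symmDiff V {e.2} = V.erase e.2 := by
      ext z
      simp only [Finset.mem_symmDiff, Finset.mem_singleton, Finset.mem_erase]
      grind
    rw [hs]
  · rw [coef_iterate_eq_zero, mul_zero]
    · intro z hz
      rcases Finset.mem_symmDiff.1 hz with h | h
      · exact hV h.1
      · rw [Finset.mem_singleton.1 h.1]
        exact he'.2.1
    · have : V ⊆ symmDiff V {e.2} := by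
        intro z hz
        simp only [Finset.mem_symmDiff, Finset.mem_singleton]
        grind
      have := Finset.card_le_card this
      omega

/-- The `σ₃` exponents of the product over the edges `(q v, v)`, `v ∈ V`. -/
def tails (q : Site → Site) (V : Finset Site) : Site → Fin 2 := ∑ v ∈ V, delta (q v)

theorem tails_apply (q : Site → Site) (V : Finset Site) (x : Site) :
    tails q V x = ∑ v ∈ V, delta (q v) x := by
  simp [tails]

theorem add_delta_delta (u : Site → Fin 2) (x : Site) : u + delta x + delta x = u := by
  ext z
  simp [add_assoc, fin2_add_self]

theorem tails_update {q : Site → Site} {V : Finset Site} {y : Site} (hy : y ∈ V) (x : Site) :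
    tails (Function.update q y x) V = tails q (V.erase y) + delta x := by
  rw [tails, ← Finset.sum_erase_add _ _ hy]
  simp only [Function.update_self]
  congr 1
  refine Finset.sum_congr rfl fun v hv => ?_
  rw [Function.update_of_ne (Finset.ne_of_mem_erase hv)]

/-- A nonzero coefficient comes from a choice of one edge into each site of `V`; `q` records the
tails of these edges. -/
theorem exists_tails_of_coef_ne_zero {L : Finset Site} (n : ℕ) (u : Site → Fin 2) (V : Finset Site)
    (hV : V ⊆ L) (hn : V.card = n)
    (h : coef u (delta 0 + ind V) ((comm (edgeSum L))^[n] (flipOp L)) ≠ 0) :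
    ∃ q : Site → Site, (∀ v ∈ V, (q v, v) ∈ edges L) ∧ ∀ x ∈ L, u x = tails q V x := by
  induction n generalizing u V with
  | zero =>
    obtain rfl := Finset.card_eq_zero.1 hn
    refine ⟨id, by simp, fun x hx => ?_⟩
    by_contra hne
    refine h (coef_flipOp_of_ne_zero _ hx ?_)
    simpa [tails] using hne
  | succ n ih =>
    rw [coef_iterate_succ u hV hn] at h
    obtain ⟨e, he, hne⟩ := Finset.exists_ne_zero_of_sum_ne_zero h
    obtain ⟨heL, heV⟩ := Finset.mem_filter.1 he
    obtain ⟨q, hq, hu⟩ := ih (u + delta e.1) (V.erase e.2) ((Finset.erase_subset _ _).trans hV)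
      (by rw [Finset.card_erase_of_mem heV, hn]; rfl) (right_ne_zero_of_mul hne)
    refine ⟨Function.update q e.2 e.1, fun v hv => ?_, fun x hx => ?_⟩
    · by_cases hve : v = e.2
      · subst hve
        simpa using heL
      · rw [Function.update_of_ne hve]
        exact hq v (Finset.mem_erase.2 ⟨hve, hv⟩)
    · rw [tails_update heV, Pi.add_apply, ← hu x hx, ← Pi.add_apply, add_delta_delta]

/-- A set of edges with pairwise distinct heads is determined by the parities of its
out-degrees. -/
theorem eqOn_of_tails_eq {L V : Finset Site} {p q : Site → Site}
    (hp : ∀ v ∈ V, (p v, v) ∈ edges L) (hq : ∀ v ∈ V, (q v, v) ∈ edges L)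
    (h : ∀ x ∈ L, tails p V x = tails q V x) : ∀ v ∈ V, p v = q v := by
  by_contra hcon
  push Not at hcon
  obtain ⟨v0, hv0, hne0⟩ := hcon
  -- Take the rightmost column containing a disagreement. At `v` one of the two maps picks the upper
  -- neighbour `x`, the other the left one. The only other possible head of an edge from `x` lies
  -- one column further right, where the maps agree; so the parities at `x` differ.
  obtain ⟨v, hv, hmax⟩ := Finset.exists_max_image (V.filter fun v => p v ≠ q v) (fun v => v.1)
    ⟨v0, Finset.mem_filter.2 ⟨hv0, hne0⟩⟩
  obtain ⟨hvV, hne⟩ := Finset.mem_filter.1 hv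
  have cases_of : ∀ x y : Site, IsEdge x y → x = y - (1, 0) ∨ x = y + (0, 1) := by
    rintro x y (rfl | rfl) <;> simp
  have hpv := cases_of _ _ (mem_edges.1 (hp v hvV)).2.2
  have hqv := cases_of _ _ (mem_edges.1 (hq v hvV)).2.2
  set x := v + (0, 1) with hx
  have hxL : x ∈ L := by
    rcases hpv with h1 | h1
    · rcases hqv with h2 | h2
      · exact absurd (h1.trans h2.symm) hne
      · rw [← h2]; exact (mem_edges.1 (hq v hvV)).1
    · rw [← h1]; exact (mem_edges.1 (hp v hvV)).1
  have hrest : ∑ z ∈ V.erase v, delta (p z) x = ∑ z ∈ V.erase v, delta (q z) x := by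
    refine Finset.sum_congr rfl fun z hz => ?_
    obtain ⟨hzv, hzV⟩ := Finset.mem_erase.1 hz
    by_cases hz' : p z = q z
    · rw [hz']
    have hle := hmax z (Finset.mem_filter.2 ⟨hzV, hz'⟩)
    have key : ∀ y, IsEdge y z → x ≠ y := by
      intro y hy hxy
      rcases cases_of _ _ hy with h1 | h1
      · have := congrArg Prod.fst (hxy.trans h1)
        simp [hx] at this
        omega
      · exact hzv (add_right_cancel (hx.symm.trans (hxy.trans h1))).symm
    rw [delta, delta, if_neg (key _ (mem_edges.1 (hp z hzV)).2.2),
      if_neg (key _ (mem_edges.1 (hq z hzV)).2.2)]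
  have hsum := h x hxL
  rw [tails_apply, tails_apply, ← Finset.sum_erase_add _ _ hvV, ← Finset.sum_erase_add _ _ hvV,
    hrest, add_right_inj] at hsum
  have hxx : x ≠ v - (1, 0) := by
    intro h1
    have := congrArg Prod.fst h1
    simp [hx] at this
    omega
  rcases hpv with h1 | h1 <;> rcases hqv with h2 | h2
  · exact hne (h1.trans h2.symm)
  · rw [h1, h2, delta, delta, if_neg hxx] at hsum
    simp at hsum
  · rw [h1, h2, delta, delta, if_neg hxx] at hsum
    simp at hsum
  · exact hne (h1.trans h2.symm)

/-- The coefficient, in the commutator of order `|V|`, of the product over the edges `(p v, v)`,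
`v ∈ V`. -/
def treeCoef (L : Finset Site) (p : Site → Site) (V : Finset Site) : ℂ :=
  coef (tails p V) (delta 0 + ind V) ((comm (edgeSum L))^[V.card] (flipOp L))

/-- The sum over the last edge reduces to edges of the tree: any other edge `(x, y)` with a nonzero
term would complete a second edge set with the same heads and tail parities, against
`eqOn_of_tails_eq`. -/
theorem treeCoef_eq {L V : Finset Site} {p : Site → Site} (hV : V.Nonempty)
    (hp : ∀ v ∈ V, (p v, v) ∈ edges L) :
    treeCoef L p V = ∑ y ∈ V, ((eps (tails p V y) 1 - eps 1 ((delta 0 + ind V) (p y)) : ℤ) : ℂ) *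
      treeCoef L p (V.erase y) := by
  have hVL : V ⊆ L := fun v hv => (mem_edges.1 (hp v hv)).2.1
  obtain ⟨n, hn⟩ : ∃ n, V.card = n + 1 := ⟨V.card - 1, by have := hV.card_pos; omega⟩
  rw [treeCoef, hn, coef_iterate_succ _ hVL hn]
  have himg : (V.image fun y => (p y, y)) ⊆ (edges L).filter fun e => e.2 ∈ V := by
    intro e he
    obtain ⟨y, hy, rfl⟩ := Finset.mem_image.1 he
    exact Finset.mem_filter.2 ⟨hp y hy, hy⟩
  rw [← Finset.sum_subset himg, Finset.sum_image]
  · refine Finset.sum_congr rfl fun y hy => ?_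
    have hyL := mem_edges.1 (hp y hy)
    have hc : (V.erase y).card = n := by rw [Finset.card_erase_of_mem hy, hn]; rfl
    have ht : tails p V + delta (p y) = tails p (V.erase y) := by
      rw [tails, ← Finset.sum_erase_add _ _ hy, ← tails, add_delta_delta]
    simp only
    rw [treeCoef, hc, ht, chi_delta_right _ hyL.2.1, chi_delta_left hyL.1]
    rfl
  · intro a _ b _ hab
    exact congrArg Prod.snd hab
  · rintro ⟨x, y⟩ he hnot
    obtain ⟨heL, heV⟩ := Finset.mem_filter.1 he
    simp only at heV ⊢
    by_contra hne
    obtain ⟨q, hq, hu⟩ := exists_tails_of_coef_ne_zero n _ (V.erase y)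
      ((Finset.erase_subset _ _).trans hVL) (by rw [Finset.card_erase_of_mem heV, hn]; rfl)
      (right_ne_zero_of_mul hne)
    have := eqOn_of_tails_eq (q := Function.update q y x) hp (fun v hv => ?_) (fun z hz => ?_) y heV
    · rw [Function.update_self] at this
      exact hnot (Finset.mem_image.2 ⟨y, heV, by rw [this]⟩)
    · by_cases hve : v = y
      · subst hve
        simpa using heL
      · rw [Function.update_of_ne hve]
        exact hq v (Finset.mem_erase.2 ⟨hve, hv⟩)
    · rw [tails_update heV, Pi.add_apply, ← hu z hz, ← Pi.add_apply, add_delta_delta]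

/-- `V` contains the parent of each of its elements, unless this is the root. -/
def ParentClosed (p : Site → Site) (V : Finset Site) : Prop := ∀ v ∈ V, p v = 0 ∨ p v ∈ V

theorem tails_eq_zero {p : Site → Site} {V : Finset Site} {y : Site} (h : ∀ v ∈ V, p v ≠ y) :
    tails p V y = 0 := by
  rw [tails_apply]
  exact Finset.sum_eq_zero fun v hv => if_neg (h v hv).symm

/-- A disconnected edge set cannot be built up. If the last edge is the only one whose tail is not
reached, it meets no earlier edge or origin factor that fails to commute with it, and its commutator
vanishes; otherwise the edge set was already disconnected before. -/
theorem treeCoef_eq_zero {L : Finset Site} {p : Site → Site} (V : Finset Site) (h0 : 0 ∉ V)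
    (hp : ∀ v ∈ V, (p v, v) ∈ edges L) (hc : ¬ ParentClosed p V) : treeCoef L p V = 0 := by
  induction V using Finset.strongInduction with
  | H V ih =>
  have hc' := hc
  simp only [ParentClosed] at hc'
  push Not at hc'
  obtain ⟨v, hv, hv0, hvV⟩ := hc'
  rw [treeCoef_eq ⟨v, hv⟩ hp]
  refine Finset.sum_eq_zero fun y hy => ?_
  by_cases hcl : ParentClosed p (V.erase y)
  · have hvy : v = y := by
      by_contra hne
      rcases hcl v (Finset.mem_erase.2 ⟨hne, hv⟩) with h | h
      · exact hv0 h
      · exact hvV (Finset.mem_of_mem_erase h)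
    subst hvy
    have h1 : tails p V v = 0 := by
      refine tails_eq_zero fun z hz hzv => ?_
      by_cases hne : z = v
      · exact (mem_edges.1 (hp v hv)).2.2.ne (hne ▸ hzv)
      · rcases hcl z (Finset.mem_erase.2 ⟨hne, hz⟩) with h | h
        · exact h0 (by rw [← h, hzv]; exact hv)
        · exact (Finset.mem_erase.1 h).1 hzv
    have h2 : (delta 0 + ind V) (p v) = 0 := by
      simp [delta, ind, hv0, hvV]
    rw [h1, h2]
    simp [eps]
  · rw [ih _ (Finset.erase_ssubset hy) (fun h => h0 (Finset.mem_of_mem_erase h))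
      (fun z hz => hp z (Finset.mem_of_mem_erase hz)) hcl, mul_zero]

/-- `a` is a proper ancestor of `b`. -/
def Ancestor (p : Site → Site) : Site → Site → Prop :=
  Relation.TransGen fun a b => p b = a ∧ b ≠ 0

theorem Ancestor.lt {p : Site → Site} (hp : ∀ v, IsEdge (p v) v) {a b : Site}
    (h : Ancestor p a b) : a.1 - a.2 < b.1 - b.2 := by
  have step : ∀ v, (p v).1 - (p v).2 < v.1 - v.2 := by
    intro v
    rcases hp v with h | h <;>
    · have h1 := congrArg Prod.fst h
      have h2 := congrArg Prod.snd h
      simp at h1 h2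
      omega
  induction h with
  | single h => rw [← h.1]; exact step _
  | tail _ h ih => rw [← h.1] at ih; exact ih.trans (step _)

theorem isStrictOrder_ancestor {p : Site → Site} (hp : ∀ v, IsEdge (p v) v) :
    IsStrictOrder Site (Ancestor p) where
  irrefl _ h := lt_irrefl _ (h.lt hp)
  trans _ _ _ h1 h2 := Relation.TransGen.trans h1 h2

theorem Ancestor.exists_child {p : Site → Site} {V : Finset Site} (hc : ParentClosed p V)
    {y z : Site} (h : Ancestor p y z) (hz : z ∈ V) : ∃ c ∈ V, p c = y := by
  induction h with
  | single h => exact ⟨_, hz, h.1⟩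
  | @tail b c h1 h ih =>
    -- The parent map is defined at the root too; the condition `b ≠ 0` in `Ancestor` keeps chains
    -- from passing through the root.
    have hb : b ≠ 0 := by
      cases h1 with
      | single h => exact h.2
      | tail _ h => exact h.2
    rcases hc _ hz with h2 | h2
    · exact absurd (h.1.symm.trans h2) hb
    · exact ih (h.1 ▸ h2)

/-- The last edge attached must end in a leaf, and it contributes the factor `+2`. Hence the
coefficient is `2` times the sum of those with one leaf removed, the recursion of linear extensions,
and `card_mul_hookWeight_le` is the matching inequality for the hook weight. -/
theorem le_re_treeCoef {L : Finset Site} {p : Site → Site} (hp : ∀ v, IsEdge (p v) v)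
    (V : Finset Site) (h0 : 0 ∉ V) (hpL : ∀ v ∈ V, (p v, v) ∈ edges L) (hc : ParentClosed p V) :
    2 ^ L.card * (2 ^ V.card * V.card.factorial * hookWeight (Ancestor p) V) ≤
      (treeCoef L p V).re := by
  classical
  have := isStrictOrder_ancestor hp
  induction V using Finset.strongInduction with
  | H V ih =>
  rcases V.eq_empty_or_nonempty with rfl | hne
  · have h1 : tails p ∅ = 0 := by simp [tails]
    have h2 : delta 0 + ind ∅ = delta 0 := by
      ext x
      simp [ind]
    rw [treeCoef, h1, h2, Finset.card_empty, Function.iterate_zero, id, coef_flipOp_zero]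
    have : ((2 : ℂ) ^ L.card).re = 2 ^ L.card := by
      rw [show (2 : ℂ) = ((2 : ℝ) : ℂ) by simp, ← Complex.ofReal_pow, Complex.ofReal_re]
    rw [this]
    simp [hookWeight]
  have key : treeCoef L p V =
      ∑ y ∈ V with ∀ z ∈ V, ¬ Ancestor p y z, 2 * treeCoef L p (V.erase y) := by
    rw [treeCoef_eq hne hpL, Finset.sum_filter]
    refine Finset.sum_congr rfl fun y hy => ?_
    split_ifs with hmax
    -- At a leaf `y` there is no `σ₃`, while its parent carries a `σ₁` (as the root or as an element
    -- of `V`): the factor is `1 - (-1)`.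
    · have h1 : tails p V y = 0 := by
        refine tails_eq_zero fun z hz hzy => hmax z hz (Relation.TransGen.single ⟨hzy, ?_⟩)
        rintro rfl
        exact h0 hz
      have h2 : (delta 0 + ind V) (p y) = 1 := by
        rcases hc y hy with h | h
        · simp [delta, ind, h, h0]
        · have : p y ≠ 0 := fun h' => h0 (h' ▸ h)
          simp [delta, ind, h, this]
      rw [h1, h2]
      norm_num [eps]
    -- Removing a site that still has a child leaves that child without its parent.
    · push Not at hmax
      obtain ⟨z, hz, hyz⟩ := hmax
      obtain ⟨c, hcV, hcy⟩ := hyz.exists_child hc hz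
      rw [treeCoef_eq_zero _ (fun h => h0 (Finset.mem_of_mem_erase h))
        (fun z hz => hpL z (Finset.mem_of_mem_erase hz)), mul_zero]
      intro hcl
      have hcne : c ≠ y := by
        rintro rfl
        exact (hp c).ne hcy
      rcases hcl c (Finset.mem_erase.2 ⟨hcne, hcV⟩) with h | h
      · exact h0 (by rw [← h, hcy]; exact hy)
      · exact (Finset.mem_erase.1 h).1 hcy
  obtain ⟨n, hn⟩ : ∃ n, V.card = n + 1 := ⟨V.card - 1, by have := hne.card_pos; omega⟩
  rw [key, Complex.re_sum]
  calc _ = 2 ^ L.card * 2 ^ (n + 1) * n.factorial * (V.card * hookWeight (Ancestor p) V) := by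
        rw [hn, Nat.factorial_succ]
        push_cast
        ring
    _ ≤ 2 ^ L.card * 2 ^ (n + 1) * n.factorial *
        ∑ y ∈ V with ∀ z ∈ V, ¬ Ancestor p y z, hookWeight (Ancestor p) (V.erase y) := by
        refine mul_le_mul_of_nonneg_left ?_ (by positivity)
        refine (card_mul_hookWeight_le (Ancestor p) V).trans (le_of_eq ?_)
        congr!
    _ ≤ _ := by
        rw [Finset.mul_sum]
        refine Finset.sum_le_sum fun y hy => ?_
        obtain ⟨hyV, hmax⟩ := Finset.mem_filter.1 hy
        have hcard : (V.erase y).card = n := by rw [Finset.card_erase_of_mem hyV, hn]; rfl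
        have := ih (V.erase y) (Finset.erase_ssubset hyV) (fun h => h0 (Finset.mem_of_mem_erase h))
          (fun z hz => hpL z (Finset.mem_of_mem_erase hz)) (fun z hz => ?_)
        · rw [hcard] at this
          have h2 : (2 * treeCoef L p (V.erase y)).re = 2 * (treeCoef L p (V.erase y)).re := by
            simp
          rw [h2]
          calc _ = 2 * (2 ^ L.card * (2 ^ n * n.factorial *
                hookWeight (Ancestor p) (V.erase y))) := by ring
            _ ≤ _ := by linarith
        · have hzV := Finset.mem_of_mem_erase hz
          refine (hc z hzV).imp_right fun h => Finset.mem_erase.2 ⟨fun hzy => ?_, h⟩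
          exact hmax z hzV (Relation.TransGen.single ⟨hzy, fun hz0 => h0 (hz0 ▸ hzV)⟩)

/-! ### A hierarchical spanning tree of the dyadic squares -/

open Classical in
/-- The parent of a site in the hierarchical tree: the upper neighbour if the row is divisible by
at most as many powers of two as the column, and the left neighbour otherwise. -/
def parent (v : Site) : Site :=
  if ∀ k : ℕ, (2 : ℤ) ^ k ∣ v.2 → (2 : ℤ) ^ k ∣ v.1 then v + (0, 1) else v - (1, 0)

theorem isEdge_parent (v : Site) : IsEdge (parent v) v := by
  unfold parent IsEdge
  split_ifs
  · right; simp
  · left; simp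

/-- The dyadic square of side `2 ^ m` to the lower right of the origin. -/
def dyadicBox (m : ℕ) : Finset Site :=
  (Finset.range (2 ^ m) ×ˢ Finset.range (2 ^ m)).image fun v => ((v.1 : ℤ), -(v.2 : ℤ))

theorem mem_dyadicBox {m : ℕ} {v : Site} :
    v ∈ dyadicBox m ↔ (0 ≤ v.1 ∧ v.1 < 2 ^ m) ∧ (-2 ^ m < v.2 ∧ v.2 ≤ 0) := by
  have h2 : ((2 ^ m : ℕ) : ℤ) = 2 ^ m := by push_cast; rfl
  simp only [dyadicBox, Finset.mem_image, Finset.mem_product, Finset.mem_range]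
  constructor
  · rintro ⟨⟨a, b⟩, ⟨h1, h3⟩, rfl⟩
    simp only at h1 h3 ⊢
    omega
  · rintro ⟨⟨h1, h3⟩, h4, h5⟩
    refine ⟨(v.1.toNat, (-v.2).toNat), ⟨?_, ?_⟩, ?_⟩
    · simp only; omega
    · simp only; omega
    · ext <;> simp <;> omega

theorem injective_dyadic :
    Function.Injective fun v : ℕ × ℕ => (((v.1 : ℤ), -(v.2 : ℤ)) : Site) := by
  rintro ⟨a, b⟩ ⟨c, d⟩ h
  simpa using h

theorem card_dyadicBox (m : ℕ) : (dyadicBox m).card = 4 ^ m := by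
  rw [dyadicBox, Finset.card_image_of_injective _ injective_dyadic, Finset.card_product,
    Finset.card_range, ← mul_pow]
  norm_num

/-- The vertices of the hierarchical tree other than its root. -/
def treeVertices (m : ℕ) : Finset Site := (dyadicBox m).erase 0

theorem zero_mem_dyadicBox (m : ℕ) : (0 : Site) ∈ dyadicBox m := by
  have : (0 : ℤ) < 2 ^ m := by positivity
  rw [mem_dyadicBox]
  simp [this]

theorem card_treeVertices (m : ℕ) : (treeVertices m).card = 4 ^ m - 1 := by
  rw [treeVertices, Finset.card_erase_of_mem (zero_mem_dyadicBox m), card_dyadicBox]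

theorem parent_mem_dyadicBox {m : ℕ} {v : Site} (hv : v ∈ treeVertices m) :
    parent v ∈ dyadicBox m := by
  obtain ⟨hv0, hvb⟩ := Finset.mem_erase.1 hv
  rw [mem_dyadicBox] at hvb ⊢
  unfold parent
  split_ifs with h
  · have h2 : v.2 ≠ 0 := by
      intro h2
      have h1 : v.1 = 0 := Int.eq_zero_of_dvd_of_nonneg_of_lt hvb.1.1 hvb.1.2
        (h m (h2 ▸ dvd_zero _))
      exact hv0 (Prod.ext h1 h2)
    simp only [Prod.fst_add, Prod.snd_add]
    omega
  · have h1 : v.1 ≠ 0 := by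
      intro h1
      exact h fun k _ => h1 ▸ dvd_zero _
    simp only [Prod.fst_sub, Prod.snd_sub]
    omega

theorem parentClosed_treeVertices (m : ℕ) : ParentClosed parent (treeVertices m) := by
  intro v hv
  by_cases h : parent v = 0
  · exact Or.inl h
  · exact Or.inr (Finset.mem_erase.2 ⟨h, parent_mem_dyadicBox hv⟩)

/-- Descendants never cross the grid of rows and columns divisible by `2 ^ K`: a site on a grid row
hangs from above only if its column is a grid column too, and a site on a grid column hangs from the
left only if its row is a grid row too. The first crossing is therefore impossible. -/
theorem ancestor_parent_bound {K : ℕ} {v z : Site} (h1 : ¬ (2 : ℤ) ^ K ∣ v.1)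
    (h2 : ¬ (2 : ℤ) ^ K ∣ v.2) (h : Ancestor parent v z) :
    (v.1 ≤ z.1 ∧ ∀ c, v.1 ≤ c → c ≤ z.1 → ¬ (2 : ℤ) ^ K ∣ c) ∧
      (z.2 ≤ v.2 ∧ ∀ c, z.2 ≤ c → c ≤ v.2 → ¬ (2 : ℤ) ^ K ∣ c) := by
  have step : ∀ z, ((v.1 ≤ (parent z).1 ∧ ∀ c, v.1 ≤ c → c ≤ (parent z).1 → ¬ (2 : ℤ) ^ K ∣ c) ∧
      ((parent z).2 ≤ v.2 ∧ ∀ c, (parent z).2 ≤ c → c ≤ v.2 → ¬ (2 : ℤ) ^ K ∣ c)) →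
      ((v.1 ≤ z.1 ∧ ∀ c, v.1 ≤ c → c ≤ z.1 → ¬ (2 : ℤ) ^ K ∣ c) ∧
      (z.2 ≤ v.2 ∧ ∀ c, z.2 ≤ c → c ≤ v.2 → ¬ (2 : ℤ) ^ K ∣ c)) := by
    intro z
    unfold parent
    split_ifs with hz
    · simp only [Prod.fst_add, Prod.snd_add, add_zero]
      rintro ⟨⟨h3, h4⟩, h5, h6⟩
      refine ⟨⟨h3, h4⟩, by omega, fun c hc hc' hd => ?_⟩
      rcases hc.eq_or_lt with rfl | hlt
      · exact h4 z.1 h3 le_rfl (hz K hd)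
      · exact h6 c (by omega) hc' hd
    · simp only [Prod.fst_sub, Prod.snd_sub, sub_zero]
      rintro ⟨⟨h3, h4⟩, h5, h6⟩
      refine ⟨⟨by omega, fun c hc hc' hd => ?_⟩, h5, h6⟩
      rcases hc'.eq_or_lt with rfl | hlt
      · push Not at hz
        obtain ⟨k, hk, hk'⟩ := hz
        have hKk : K ≤ k := by
          by_contra hlt
          exact hk' ((pow_dvd_pow 2 (by omega)).trans hd)
        exact h6 z.2 le_rfl h5 ((pow_dvd_pow 2 hKk).trans hk)
      · exact h4 c hc (by omega) hd
  induction h with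
  | @single b h =>
    refine step b ?_
    rw [h.1]
    exact ⟨⟨le_rfl, fun c hc hc' => by rwa [le_antisymm hc' hc]⟩,
      le_rfl, fun c hc hc' => by rwa [le_antisymm hc' hc]⟩
  | @tail b c _ h ih =>
    refine step c ?_
    rw [h.1]
    exact ih

theorem lt_of_no_multiple {q a b : ℤ} (hq : 0 < q) (h : ∀ c, a ≤ c → c ≤ b → ¬ q ∣ c) :
    b < a + q := by
  by_contra hcon
  have h1 := Int.emod_nonneg (-a) hq.ne'
  have h2 := Int.emod_lt_of_pos (-a) hq
  -- The least multiple of `q` that is at least `a`.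
  refine h (a + (-a) % q) (by omega) (by omega) ⟨-(-a / q), ?_⟩
  have := Int.emod_add_mul_ediv (-a) q
  linarith

theorem above_add_one_le {V : Finset Site} {K : ℕ} {v : Site} (h1 : ¬ (2 : ℤ) ^ K ∣ v.1)
    (h2 : ¬ (2 : ℤ) ^ K ∣ v.2) : above (Ancestor parent) V v + 1 ≤ 4 ^ K := by
  classical
  have hirr : ¬ Ancestor parent v v := fun h => lt_irrefl _ (h.lt isEdge_parent)
  have hpos : (0 : ℤ) < 2 ^ K := by positivity
  unfold above
  rw [← Finset.card_insert_of_notMem (a := v) (by simp [hirr])]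
  have hsub : insert v (V.filter fun z => Ancestor parent v z) ⊆
      Finset.Ico v.1 (v.1 + 2 ^ K) ×ˢ Finset.Ioc (v.2 - 2 ^ K) v.2 := by
    intro z hz
    rw [Finset.mem_product, Finset.mem_Ico, Finset.mem_Ioc]
    rcases Finset.mem_insert.1 hz with rfl | hz
    · omega
    · obtain ⟨⟨h3, h4⟩, h5, h6⟩ := ancestor_parent_bound h1 h2 (Finset.mem_filter.1 hz).2
      have h7 := lt_of_no_multiple hpos h4
      have h8 := lt_of_no_multiple hpos h6
      omega
  refine le_trans (le_of_eq (by congr!)) ((Finset.card_le_card hsub).trans (le_of_eq ?_))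
  rw [Finset.card_product, Int.card_Ico, Int.card_Ioc, add_sub_cancel_left, sub_sub_cancel]
  have : ((2 : ℤ) ^ K).toNat = 2 ^ K := by
    rw [show (2 : ℤ) ^ K = ((2 ^ K : ℕ) : ℤ) by push_cast; rfl, Int.toNat_natCast]
  rw [this, ← mul_pow]
  norm_num

/-- The exponent of two in `a`, with value `m` at `a = 0`. -/
def ruler (m a : ℕ) : ℕ := if a = 0 then m else padicValNat 2 a

theorem sum_ruler (m N : ℕ) : ∑ a ∈ Finset.range (N + 1), ruler m a =
    m + padicValNat 2 N.factorial := by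
  induction N with
  | zero => simp [ruler]
  | succ N ih =>
    rw [Finset.sum_range_succ, ih, Nat.factorial_succ,
      padicValNat.mul (by omega) (Nat.factorial_ne_zero N)]
    simp [ruler]
    ring

/-- By Legendre's formula the exponent of two in `(2 ^ m - 1)!` is at most `2 ^ m - 1`, and the
value `m` at zero is below `2 ^ m`. -/
theorem sum_ruler_le (m : ℕ) : ∑ a ∈ Finset.range (2 ^ m), ruler m a ≤ 2 * 2 ^ m := by
  have h : 2 ^ m = (2 ^ m - 1) + 1 := by have := Nat.one_le_two_pow (n := m); omega
  have h1 : padicValNat 2 (2 ^ m - 1).factorial ≤ 2 ^ m - 1 := by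
    have := sub_one_mul_padicValNat_factorial (p := 2) (2 ^ m - 1)
    simp only [Nat.add_one_sub_one, one_mul] at this
    omega
  have h2 : m < 2 ^ m := Nat.lt_two_pow_self
  conv_lhs => rw [h]
  rw [sum_ruler]
  omega

/-- Off the axes, any `K` exceeding both exponents of two confines the descendants to a cell of side
`2 ^ K`; the sum of the exponents is used instead of their maximum because it is easy to add up. On
the axes the size of the whole tree suffices, which is why `ruler m 0 = m`. -/
theorem above_treeVertices_le {m : ℕ} (v : Site) :
    above (Ancestor parent) (treeVertices m) v + 1 ≤
      4 ^ (1 + ruler m v.1.natAbs + ruler m v.2.natAbs) := by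
  classical
  by_cases h0 : v.1 = 0 ∨ v.2 = 0
  · have h1 : above (Ancestor parent) (treeVertices m) v ≤ 4 ^ m - 1 := by
      rw [← card_treeVertices]
      exact Finset.card_le_card (Finset.filter_subset _ _)
    have h2 : m ≤ 1 + ruler m v.1.natAbs + ruler m v.2.natAbs := by
      rcases h0 with h | h
      · simp only [h, ruler, Int.natAbs_zero, if_true]; omega
      · simp only [h, ruler, Int.natAbs_zero, if_true]; omega
    have h3 : 1 ≤ 4 ^ m := Nat.one_le_pow _ _ (by norm_num)
    have h4 : 4 ^ m ≤ 4 ^ (1 + ruler m v.1.natAbs + ruler m v.2.natAbs) :=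
      Nat.pow_le_pow_right (by norm_num) h2
    omega
  · push Not at h0
    have key : ∀ a : ℤ, a ≠ 0 → ∀ k, padicValNat 2 a.natAbs < k → ¬ (2 : ℤ) ^ k ∣ a := by
      intro a ha k hk hd
      have := (padicValInt_dvd_iff (p := 2) k a).1 (by exact_mod_cast hd)
      rcases this with h | h
      · exact ha h
      · unfold padicValInt at h
        omega
    refine above_add_one_le (key _ h0.1 _ ?_) (key _ h0.2 _ ?_)
    · have : v.1.natAbs ≠ 0 := by simpa using h0.1
      simp only [ruler, this, if_false]
      omega
    · have : v.2.natAbs ≠ 0 := by simpa using h0.2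
      simp only [ruler, this, if_false]
      omega

/-- The exponents of two are bounded on average: the terms `1`, row and column contribute at most `1
+ 2 + 2 = 5` per site. -/
theorem le_hookWeight_treeVertices (m : ℕ) :
    ((4 : ℝ) ^ (5 * 4 ^ m))⁻¹ ≤ hookWeight (Ancestor parent) (treeVertices m) := by
  have hsum : ∑ v ∈ treeVertices m, (1 + ruler m v.1.natAbs + ruler m v.2.natAbs) ≤
      5 * 4 ^ m := by
    calc _ ≤ ∑ v ∈ dyadicBox m, (1 + ruler m v.1.natAbs + ruler m v.2.natAbs) :=
          Finset.sum_le_sum_of_subset (Finset.erase_subset _ _)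
      _ = 2 ^ m * 2 ^ m + 2 ^ m * ∑ a ∈ Finset.range (2 ^ m), ruler m a +
          2 ^ m * ∑ a ∈ Finset.range (2 ^ m), ruler m a := by
          rw [dyadicBox, Finset.sum_image injective_dyadic.injOn, Finset.sum_product]
          simp [Finset.sum_add_distrib, Finset.mul_sum, mul_add]
      _ ≤ 2 ^ m * 2 ^ m + 2 ^ m * (2 * 2 ^ m) + 2 ^ m * (2 * 2 ^ m) := by
          gcongr <;> exact sum_ruler_le m
      _ = 5 * 4 ^ m := by
          rw [show 4 = 2 * 2 by norm_num, mul_pow]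
          ring
  rw [hookWeight, Finset.prod_inv_distrib]
  refine inv_anti₀ (Finset.prod_pos fun e _ => by positivity) ?_
  calc _ ≤ ∏ v ∈ treeVertices m, (4 : ℝ) ^ (1 + ruler m v.1.natAbs + ruler m v.2.natAbs) :=
        Finset.prod_le_prod (fun _ _ => by positivity) fun v _ => by
          exact_mod_cast above_treeVertices_le v
    _ = 4 ^ ∑ v ∈ treeVertices m, (1 + ruler m v.1.natAbs + ruler m v.2.natAbs) :=
        Finset.prod_pow_eq_pow_sum _ _ _
    _ ≤ _ := pow_le_pow_right₀ (by norm_num) hsum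

/-! ### The interaction in terms of Pauli operators -/

theorem IsEdge.lt {x y : Site} (h : IsEdge x y) : x.1 - x.2 < y.1 - y.2 := by
  rcases h with rfl | rfl <;> simp

/-- Column minus row increases along every edge, so an unordered pair remembers its orientation.
This turns the sum over subsets in the Hamiltonian into a sum over directed edges. -/
theorem IsEdge.pair_injective {x y x' y' : Site} (h : IsEdge x y) (h' : IsEdge x' y')
    (he : ({x, y} : Finset Site) = {x', y'}) : x = x' ∧ y = y' := by
  have hx : x ∈ ({x', y'} : Finset Site) := by rw [← he]; simp
  have hy : y ∈ ({x', y'} : Finset Site) := by rw [← he]; simp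
  simp only [Finset.mem_insert, Finset.mem_singleton] at hx hy
  have h1 := h.lt
  have h2 := h'.lt
  rcases hx with rfl | rfl <;> rcases hy with rfl | rfl
  · omega
  · exact ⟨rfl, rfl⟩
  · omega
  · omega

theorem crossInteraction_eq_zero {X : Finset Site} (h : ¬ ∃ x y, IsEdge x y ∧ X = {x, y}) :
    crossInteraction X = 0 := by
  ext s t
  refine Finset.sum_eq_zero fun x _ => Finset.sum_eq_zero fun y _ => if_neg ?_
  rintro ⟨h1, h2⟩
  exact h ⟨x, y, h2, h1⟩

theorem crossInteraction_pair_apply {x y : Site} (h : IsEdge x y)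
    (s t : {z // z ∈ ({x, y} : Finset Site)} → Fin 2) :
    crossInteraction {x, y} s t =
      alpha1 (s ⟨x, by simp⟩) (t ⟨x, by simp⟩) * alpha2 (s ⟨y, by simp⟩) (t ⟨y, by simp⟩) := by
  unfold crossInteraction
  rw [Matrix.of_apply, Finset.sum_eq_single ⟨x, by simp⟩, Finset.sum_eq_single ⟨y, by simp⟩]
  · exact if_pos ⟨rfl, h⟩
  · intro b _ hb
    refine if_neg ?_
    rintro ⟨h1, h2⟩
    exact hb (Subtype.ext (h.pair_injective h2 h1).2.symm)
  · simp
  · intro a _ ha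
    refine Finset.sum_eq_zero fun b _ => if_neg ?_
    rintro ⟨h1, h2⟩
    exact ha (Subtype.ext (h.pair_injective h2 h1).1.symm)
  · simp

theorem alpha1_apply : ∀ a b : Fin 2, alpha1 a b = if a = b then (eps 1 a : ℂ) else 0 := by
  intro a b
  fin_cases a <;> fin_cases b <;> simp [alpha1, eps]

theorem alpha2_apply : ∀ a b : Fin 2, alpha2 a b = if b = a + 1 then 1 else 0 := by
  intro a b
  fin_cases a <;> fin_cases b <;> simp [alpha2]

theorem embed_crossInteraction_pair {L : Finset Site} {x y : Site} (h : IsEdge x y) (hx : x ∈ L)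
    (hy : y ∈ L) : embed {x, y} L (crossInteraction {x, y}) = edgeOp L x y := by
  have hsub : ({x, y} : Finset Site) ⊆ L := by
    intro z hz
    simp only [Finset.mem_insert, Finset.mem_singleton] at hz
    rcases hz with rfl | rfl <;> assumption
  ext s t
  rw [embed, dif_pos hsub, Matrix.of_apply, crossInteraction_pair_apply h, alpha1_apply,
    alpha2_apply, edgeOp, Matrix.of_apply, chi_delta_left hx]
  by_cases ht : t = s + res L (delta y)
  · have h1 : ∀ z : {z // z ∈ L}, z.1 ∉ ({x, y} : Finset Site) → s z = t z := by
      intro z hz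
      simp only [Finset.mem_insert, Finset.mem_singleton, not_or] at hz
      simp [ht, res, delta, hz.2]
    rw [if_pos h1, if_pos ht, if_pos, if_pos, mul_one]
    · simp [ht, res, delta]
    · simp [ht, res, delta, h.ne]
  · rw [if_neg ht]
    split_ifs with h1 h2 h3
    · refine absurd ?_ ht
      ext z
      rw [Pi.add_apply]
      by_cases hzx : z.1 = x
      · have hz : z = ⟨x, hx⟩ := Subtype.ext hzx
        subst hz
        simp [res, delta, h.ne, ← h2]
      · by_cases hzy : z.1 = y
        · have hz : z = ⟨y, hy⟩ := Subtype.ext hzy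
          subst hz
          simp [res, delta, h3]
        · rw [← h1 z (by simp [hzx, hzy])]
          simp [res, delta, hzy]
    · simp
    · simp
    · simp
    · rfl

theorem embed_zero (X L : Finset Site) : embed X L 0 = 0 := by
  unfold embed
  split_ifs
  · ext s t
    simp
  · rfl

theorem hamiltonian_crossInteraction (L : Finset Site) :
    hamiltonian crossInteraction L = edgeSum L := by
  classical
  have himg : ((edges L).image fun e => ({e.1, e.2} : Finset Site)) ⊆ L.powerset := by
    intro X hX
    obtain ⟨⟨x, y⟩, he, rfl⟩ := Finset.mem_image.1 hX
    obtain ⟨hx, hy, -⟩ := mem_edges.1 he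
    rw [Finset.mem_powerset]
    intro z hz
    simp only [Finset.mem_insert, Finset.mem_singleton] at hz
    rcases hz with rfl | rfl <;> assumption
  rw [hamiltonian, ← Finset.sum_subset himg, Finset.sum_image]
  · refine Finset.sum_congr rfl fun e he => ?_
    obtain ⟨hx, hy, h⟩ := mem_edges.1 he
    exact embed_crossInteraction_pair h hx hy
  · intro e he e' he' h
    have h1 := (mem_edges.1 he).2.2.pair_injective (mem_edges.1 he').2.2 h
    exact Prod.ext h1.1 h1.2
  · intro X hX hnot
    rw [crossInteraction_eq_zero, embed_zero]
    rintro ⟨x, y, h, rfl⟩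
    have hsub := Finset.mem_powerset.1 hX
    exact hnot (Finset.mem_image.2
      ⟨(x, y), mem_edges.2 ⟨hsub (by simp), hsub (by simp), h⟩, rfl⟩)

theorem embed_originObs {L : Finset Site} (h0 : (0 : Site) ∈ L) :
    embed {0} L originObs = flipOp L := by
  have hsub : ({0} : Finset Site) ⊆ L := by simpa using h0
  ext s t
  rw [embed, dif_pos hsub, Matrix.of_apply, originObs, Matrix.of_apply, alpha2_apply, flipOp,
    Matrix.of_apply]
  by_cases ht : t = s + res L (delta 0)
  · rw [if_pos ht, if_pos, if_pos]
    · simp [ht, res, delta]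
    · intro z hz
      rw [Finset.mem_singleton] at hz
      simp [ht, res, delta, hz]
  · rw [if_neg ht]
    split_ifs with h1 h2
    · refine absurd ?_ ht
      ext z
      rw [Pi.add_apply]
      by_cases hz : z.1 = 0
      · have hz' : z = ⟨0, h0⟩ := Subtype.ext hz
        subst hz'
        simp [res, delta, h2]
      · rw [← h1 z (by simpa using hz)]
        simp [res, delta, hz]
    · rfl
    · rfl

theorem flipOp_isHermitian (L : Finset Site) : (flipOp L).IsHermitian := by
  ext s t
  simp only [flipOp, Matrix.conjTranspose_apply, Matrix.of_apply]
  by_cases h : t = s + res L (delta 0)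
  · rw [if_pos h, if_pos (by rw [h, add_add_self]), star_one]
  · rw [if_neg h, if_neg, star_zero]
    rintro rfl
    exact h (add_add_self _ _).symm

theorem edgeOp_isHermitian (L : Finset Site) {x y : Site} (hxy : x ≠ y) :
    (edgeOp L x y).IsHermitian := by
  ext s t
  simp only [edgeOp, Matrix.conjTranspose_apply, Matrix.of_apply]
  by_cases h : t = s + res L (delta y)
  · rw [if_pos h, if_pos (by rw [h, add_add_self]), h, chi_add_right, chi_delta_delta hxy]
    simp
  · rw [if_neg h, if_neg, star_zero]
    rintro rfl
    exact h (add_add_self _ _).symm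

theorem edgeSum_isHermitian (L : Finset Site) : (edgeSum L).IsHermitian := by
  unfold edgeSum Matrix.IsHermitian
  rw [Matrix.conjTranspose_sum]
  exact Finset.sum_congr rfl fun e he => edgeOp_isHermitian L (mem_edges.1 he).2.2.ne

theorem embed_self (X : Finset Site) (A : Obs X) : embed X X A = A := by
  ext s t
  rw [embed, dif_pos subset_rfl, Matrix.of_apply, if_pos fun x hx => absurd x.2 hx]

theorem crossInteraction_pair {x y : Site} (h : IsEdge x y) :
    crossInteraction {x, y} = edgeOp {x, y} x y := by
  rw [← embed_crossInteraction_pair h (by simp) (by simp), embed_self]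

theorem isSelfAdjointInteraction_crossInteraction :
    IsSelfAdjointInteraction crossInteraction := by
  intro X
  by_cases h : ∃ x y, IsEdge x y ∧ X = {x, y}
  · obtain ⟨x, y, hxy, rfl⟩ := h
    rw [crossInteraction_pair hxy]
    exact edgeOp_isHermitian _ hxy.ne
  · rw [crossInteraction_eq_zero h]
    exact Matrix.isHermitian_zero

theorem isNearestNeighborInteraction_crossInteraction :
    IsNearestNeighborInteraction crossInteraction := by
  intro X h
  refine crossInteraction_eq_zero ?_
  rintro ⟨x, y, hxy, hX⟩
  refine h ⟨x, y, ?_, hX⟩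
  rcases hxy with rfl | rfl <;> simp [NearestNeighbor]

theorem isTranslationInvariant_crossInteraction :
    IsTranslationInvariant crossInteraction := by
  intro a X s t
  have hbij : Function.Bijective
      (fun x : {x // x ∈ X} => (⟨x.1 + a, add_mem_translate a X x⟩ : {x // x ∈ translate a X})) := by
    constructor
    · intro x y h
      exact Subtype.ext (add_right_cancel (congrArg Subtype.val h))
    · rintro ⟨y, hy⟩
      obtain ⟨x, hx, rfl⟩ := Finset.mem_map.1 hy
      exact ⟨⟨x, hx⟩, rfl⟩
  simp only [crossInteraction, Matrix.of_apply]
  rw [← hbij.sum_comp]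
  refine Finset.sum_congr rfl fun x _ => ?_
  rw [← hbij.sum_comp]
  refine Finset.sum_congr rfl fun y _ => ?_
  have h1 : translate a X = {x.1 + a, y.1 + a} ↔ X = {x.1, y.1} := by
    have : ({x.1 + a, y.1 + a} : Finset Site) = translate a {x.1, y.1} := by
      ext z; simp [translate]
    rw [this]
    exact Finset.map_inj
  have h2 : (y.1 + a = x.1 + a + (1, 0) ∨ y.1 + a = x.1 + a - (0, 1)) ↔
      (y.1 = x.1 + (1, 0) ∨ y.1 = x.1 - (0, 1)) := by
    rw [add_right_comm, add_left_inj, ← sub_add_eq_add_sub, add_left_inj]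
  simp only [h1, h2]

theorem norm_edgeOp (L : Finset Site) {x y : Site} (hxy : x ≠ y) : ‖edgeOp L x y‖ = 1 := by
  have h1 : edgeOp L x y * edgeOp L x y = 1 := by
    ext s t
    rw [edgeOp_mul_apply, edgeOp, Matrix.of_apply, add_add_self, Matrix.one_apply]
    by_cases h : t = s
    · subst h
      rw [if_pos rfl, if_pos rfl, chi_add_right, chi_delta_delta hxy, mul_one, ← Int.cast_mul,
        chi, ← Finset.prod_mul_distrib, Finset.prod_eq_one, Int.cast_one]
      have : ∀ a b : Fin 2, eps a b * eps a b = 1 := by decide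
      exact fun _ _ => this _ _
    · rw [if_neg h, if_neg (Ne.symm h), mul_zero]
  have h2 : star (edgeOp L x y) = edgeOp L x y := edgeOp_isHermitian L hxy
  exact CStarRing.norm_of_mem_unitary (Unitary.mem_iff.2 ⟨by rw [h2, h1], by rw [h2, h1]⟩)

theorem norm_crossInteraction_pair {x y : Site} (h : NearestNeighbor x y) :
    ‖crossInteraction {x, y}‖ = 1 := by
  have hcases : IsEdge x y ∨ IsEdge y x := by
    unfold NearestNeighbor at h
    unfold IsEdge
    simp only [Prod.ext_iff, Prod.fst_add, Prod.snd_add, Prod.fst_sub, Prod.snd_sub]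
    rcases abs_cases (x.1 - y.1) with h1 | h1 <;> rcases abs_cases (x.2 - y.2) with h2 | h2 <;>
      omega
  rcases hcases with h | h
  · rw [crossInteraction_pair h, norm_edgeOp _ h.ne]
  · rw [Finset.pair_comm, crossInteraction_pair h, norm_edgeOp _ h.ne]

/-! ### Growth of the boxes -/

theorem E_lt_succ (k : ℕ) : E k < E (k + 1) := by
  cases k with
  | zero => norm_num [E]
  | succ k =>
    change E (k + 1) < 4 ^ Nat.sqrt (E (k + 1))
    have h1 : E (k + 1) < (Nat.sqrt (E (k + 1)) + 1) * (Nat.sqrt (E (k + 1)) + 1) :=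
      Nat.lt_succ_sqrt _
    have h2 : Nat.sqrt (E (k + 1)) + 1 ≤ 2 ^ Nat.sqrt (E (k + 1)) := Nat.lt_two_pow_self
    calc _ < _ := h1
      _ ≤ 2 ^ Nat.sqrt (E (k + 1)) * 2 ^ Nat.sqrt (E (k + 1)) := Nat.mul_le_mul h2 h2
      _ = _ := by rw [← mul_pow]; norm_num

theorem le_E (k : ℕ) : k ≤ E k := (strictMono_nat_of_lt_succ E_lt_succ).le_apply

theorem E_pos (k : ℕ) : 0 < E k := by
  cases k with
  | zero => norm_num [E]
  | succ k => exact (Nat.zero_le _).trans_lt (E_lt_succ k)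

theorem segment_subset_cluster (n : ℕ) (u v p : Site) :
    segment u p n ⊆ cluster n u v p := by
  intro q hq
  obtain ⟨t, ht, rfl⟩ := hq
  cases n with
  | zero => exact ⟨t, by omega, rfl⟩
  | succ n =>
    refine Or.inl ⟨t, ht.trans ?_, rfl⟩
    have h1 : 4 * E n ≤ 4 * E (n + 2) * E n / E (n + 1) := by
      rw [Nat.le_div_iff_mul_le (E_pos _)]
      have := (E_lt_succ (n + 1)).le
      calc 4 * E n * E (n + 1) ≤ 4 * E n * E (n + 2) := Nat.mul_le_mul_left _ this
        _ = _ := by ring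
    have h2 := le_E n
    have h3 := E_pos n
    omega

/-- Three points of the tree suffice: the origin, a point at distance `j` on the main segment, and a
point at depth `j - 1` on the first branch. A box containing them contains the rectangle they span.
-/
theorem dyadicBox_subset {L : Finset Site} (hL : IsSquareBox L) {m j : ℕ} (hj : 2 ^ m < j)
    (htree : unfoldedTree j ⊆ (L : Set Site)) : dyadicBox m ⊆ L := by
  obtain ⟨a, b, l, rfl⟩ := hL
  obtain ⟨n, rfl⟩ : ∃ n, j = n + 1 := ⟨j - 1, (Nat.succ_pred_eq_of_pos (Nat.zero_lt_of_lt hj)).symm⟩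
  have hright : (((n + 1 : ℕ) : ℤ), (0 : ℤ)) ∈ unfoldedTree (n + 1) :=
    segment_subset_cluster _ _ _ _ ⟨n + 1, le_rfl, by simp⟩
  have hzero : ((0 : ℤ), (0 : ℤ)) ∈ unfoldedTree (n + 1) :=
    segment_subset_cluster _ _ _ _ ⟨0, by omega, by simp⟩
  have hdown : (((4 * E n : ℕ) : ℤ), -(n : ℤ)) ∈ unfoldedTree (n + 1) := by
    refine Or.inr (Set.mem_iUnion₂.2 ⟨1, ⟨le_rfl, ?_⟩, segment_subset_cluster _ _ _ _
      ⟨n, le_rfl, by simp⟩⟩)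
    exact Nat.div_pos (E_lt_succ (n + 1)).le (E_pos _)
  have h1 := htree hright
  have h2 := htree hzero
  have h3 := htree hdown
  simp only [Finset.coe_product, Finset.coe_Icc, Set.mem_prod, Set.mem_Icc] at h1 h2 h3
  intro v hv
  have h4 := mem_dyadicBox.1 hv
  have h5 : ((2 ^ m : ℕ) : ℤ) = 2 ^ m := by push_cast; rfl
  generalize (2 : ℤ) ^ m = c at h4 h5
  generalize 2 ^ m = d at hj h5
  simp only [Finset.mem_product, Finset.mem_Icc]
  omega

/-! ### The lower bound -/

theorem factorial_two_mul_le (n : ℕ) : (2 * n).factorial ≤ 4 ^ n * (n.factorial) ^ 2 := by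
  have h1 := Nat.choose_mul_factorial_mul_factorial (n := 2 * n) (k := n) (by omega)
  have h2 : (2 * n).choose n ≤ 2 ^ (2 * n) := Nat.choose_le_two_pow _ _
  rw [show 2 * n - n = n by omega] at h1
  rw [← h1, mul_assoc, ← sq, show 4 = 2 ^ 2 by norm_num, ← pow_mul]
  exact Nat.mul_le_mul_right _ h2

/-- A tree in the region bounds the imaginary-time evolution of `σ₁` at the origin from below. -/
theorem pow_mul_hookWeight_le {L V : Finset Site} {p : Site → Site} (hp : ∀ v, IsEdge (p v) v)
    (h0 : 0 ∉ V) (hpL : ∀ v ∈ V, (p v, v) ∈ edges L) (hc : ParentClosed p V) (t : ℝ) :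
    |2 * t| ^ V.card * hookWeight (Ancestor p) V ≤
      ‖NormedSpace.exp ((t : ℂ) • edgeSum L) * flipOp L *
        NormedSpace.exp (-((t : ℂ) • edgeSum L))‖ := by
  set n := V.card with hn
  set w := hookWeight (Ancestor p) V with hw
  set X := ‖NormedSpace.exp ((t : ℂ) • edgeSum L) * flipOp L *
        NormedSpace.exp (-((t : ℂ) • edgeSum L))‖
  have hw0 : 0 ≤ w := Finset.prod_nonneg fun e _ => by positivity
  have h1 := hsSq_comm_le_evolution (edgeSum L) (flipOp L) (edgeSum_isHermitian L)
    (flipOp_isHermitian L) t n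
  have hcard : (Fintype.card ({x // x ∈ L} → Fin 2) : ℝ) = 2 ^ L.card := by simp
  rw [hcard] at h1
  -- The squared norm of the commutator of order `n` is at least the contribution of the one Pauli
  -- string of the tree.
  have h2 : (2 ^ L.card * (2 ^ n * n.factorial * w)) ^ 2 ≤
      2 ^ L.card * hsSq ((comm (edgeSum L))^[n] (flipOp L)) := by
    refine le_trans ?_ (norm_coef_sq_le (tails p V) (delta 0 + ind V) _)
    refine pow_le_pow_left₀ (by positivity) ?_ 2
    exact (le_re_treeCoef hp V h0 hpL hc).trans (Complex.re_le_norm _)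
  set Q := hsSq ((comm (edgeSum L))^[n] (flipOp L))
  have hL : (0 : ℝ) < 2 ^ L.card := by positivity
  have h3 : 2 ^ L.card * (2 ^ n * n.factorial * w) ^ 2 ≤ Q := by
    refine le_of_mul_le_mul_left (le_trans (le_of_eq ?_) h2) hL
    ring
  have hfac : (0 : ℝ) < (2 * n).factorial := by positivity
  have ht : 0 ≤ (2 * t) ^ (2 * n) := by rw [pow_mul]; positivity
  have h4 : (2 * t) ^ (2 * n) / (2 * n).factorial * (2 ^ L.card * (2 ^ n * n.factorial * w) ^ 2) ≤
      2 ^ L.card * X ^ 2 :=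
    (mul_le_mul_of_nonneg_left h3 (by positivity)).trans h1
  have h5 : ((2 * n).factorial : ℝ) ≤ 4 ^ n * n.factorial ^ 2 := by
    exact_mod_cast factorial_two_mul_le n
  refine le_of_sq_le_sq ?_ (norm_nonneg _)
  refine le_of_mul_le_mul_left (le_trans ?_ h4) hL
  -- Here the square of `2 ^ n * n!` from the linear extensions absorbs the `(2n)!` of the cosh
  -- series.
  have h6 : (2 * t) ^ (2 * n) ≤ (2 * t) ^ (2 * n) / (2 * n).factorial *
      (4 ^ n * n.factorial ^ 2) := by
    rw [div_mul_eq_mul_div, le_div_iff₀ hfac]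
    exact mul_le_mul_of_nonneg_left h5 ht
  calc 2 ^ L.card * (|2 * t| ^ n * w) ^ 2 = 2 ^ L.card * w ^ 2 * (2 * t) ^ (2 * n) := by
        rw [mul_pow, ← pow_mul, mul_comm n 2, pow_mul, sq_abs, ← pow_mul]
        ring
    _ ≤ 2 ^ L.card * w ^ 2 * ((2 * t) ^ (2 * n) / (2 * n).factorial *
        (4 ^ n * n.factorial ^ 2)) := mul_le_mul_of_nonneg_left h6 (by positivity)
    _ = _ := by
        have h7 : (4 : ℝ) ^ n = 2 ^ n * 2 ^ n := by rw [← mul_pow]; norm_num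
        rw [h7]
        ring

theorem le_norm_evolution {L : Finset Site} {m : ℕ} (hm : 1 ≤ m) (hL : dyadicBox m ⊆ L) {z : ℂ}
    (hz : z.re = 0) (hz' : 4 ^ 21 < ‖z‖) :
    (m : ℝ) ≤ ‖evolution crossInteraction L z (embed {0} L originObs)‖ := by
  have hIz : Complex.I * z = ((-z.im : ℝ) : ℂ) := by
    apply Complex.ext <;> simp [hz]
  have hnorm : ‖z‖ = |z.im| := (Complex.abs_im_eq_norm.2 hz).symm
  rw [evolution, hamiltonian_crossInteraction, embed_originObs (hL (zero_mem_dyadicBox m)), hIz]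
  refine le_trans ?_ (pow_mul_hookWeight_le isEdge_parent (Finset.notMem_erase 0 (dyadicBox m))
    (fun v hv => mem_edges.2 ⟨hL (parent_mem_dyadicBox hv), hL (Finset.mem_of_mem_erase hv),
      isEdge_parent v⟩) (parentClosed_treeVertices m) (-z.im))
  have hcard := card_treeVertices m
  rw [treeVertices] at hcard
  rw [hcard]
  have h1 := le_hookWeight_treeVertices m
  rw [treeVertices] at h1
  have h2 : (4 : ℝ) ^ 21 ≤ |2 * -z.im| := by
    rw [abs_mul, abs_neg, ← hnorm, abs_of_pos (by norm_num : (0 : ℝ) < 2)]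
    linarith [norm_nonneg z]
  have h3 : m < 4 ^ m := Nat.lt_pow_self (by norm_num)
  have h4 : 4 ^ 1 ≤ 4 ^ m := Nat.pow_le_pow_right (by norm_num) hm
  have h5 : 4 ^ m < 4 ^ (4 ^ m) := Nat.lt_pow_self (by norm_num)
  -- With `N` sites the tree has `N - 1` edges. The hook weight costs `4 ^ (5 * N)`, and `6 * N ≤ 21
  -- * (N - 1)` since `N ≥ 4`, which leaves a surplus of `4 ^ N ≥ m`.
  generalize hN : 4 ^ m = N at *
  calc (m : ℝ) ≤ 4 ^ N := by exact_mod_cast (h3.trans h5).le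
    _ = 4 ^ (N + 5 * N) * (4 ^ (5 * N))⁻¹ := by
        rw [pow_add, mul_assoc, mul_inv_cancel₀ (by positivity), mul_one]
    _ ≤ (4 ^ 21) ^ (N - 1) * (4 ^ (5 * N))⁻¹ := by
        rw [← pow_mul]
        refine mul_le_mul_of_nonneg_right ?_ (by positivity)
        exact pow_le_pow_right₀ (by norm_num) (by omega)
    _ ≤ _ := by gcongr

end SpinLattice

end

open SpinLattice

theorem mainTheorem1 :
    IsSelfAdjointInteraction crossInteraction ∧
    IsNearestNeighborInteraction crossInteraction ∧
    IsTranslationInvariant crossInteraction ∧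
    (∀ x y : Site, NearestNeighbor x y → ‖crossInteraction {x, y}‖ = 1) ∧
    ∀ Λ : ℕ → Finset Site, Monotone Λ → (∀ j, IsSquareBox (Λ j)) →
      (∀ j, 1 ≤ j → unfoldedTree j ⊆ (Λ j : Set Site)) →
      ∀ z : ℂ, z.re = 0 → 4 ^ 21 < ‖z‖ →
        Tendsto
          (fun j => ‖evolution crossInteraction (Λ j) z (embed {0} (Λ j) originObs)‖)
          atTop atTop := by
  refine ⟨isSelfAdjointInteraction_crossInteraction,
    isNearestNeighborInteraction_crossInteraction, isTranslationInvariant_crossInteraction,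
    fun x y h => norm_crossInteraction_pair h, fun Λ _ hbox htree z hz hz' => ?_⟩
  refine tendsto_atTop.2 fun r => ?_
  obtain ⟨m, hm⟩ := exists_nat_ge r
  filter_upwards [eventually_gt_atTop (2 ^ (m + 1))] with j hj
  have hsub : dyadicBox (m + 1) ⊆ Λ j :=
    dyadicBox_subset (hbox j) hj (htree j (Nat.zero_lt_of_lt hj))
  have := le_norm_evolution (by omega) hsub hz hz'
  push_cast at this
  linarith
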